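/- \textbf{Setting.} Let $\mathcal X\in\mathbb R^{n_1\times\cdots\times n_d}$, $d\ge1$, and let $\mathcal M=\prod_{i=1}^d Gr(n_i,r_i)$, a point of which is represented by a tuple $U=(U_1,\dots,U_d)$ of matrices $U_i\in\mathbb R^{n_i\times r_i}$ with $U_i^TU_i=I$ whose columns span the given subspaces. Let $$f(U)=-\tfrac12\|\mathcal X\times_1U_1^T\times_2\cdots\times_dU_d^T\|_F^2 .$$ Let $Y_{(i)}$ be the mode-$i$ unfolding of $\mathcal X\times_{-i}\{U^T\}$ (all modes except the $i$-th contracted with the $U_j^T$) and $\lambda_i=\lambda_i(U)=U_i^TY_{(i)}Y_{(i)}^TU_i$. Tangent vectors are tuples $\xi=(\xi_1,\dots,\xi_d)$ with $U_i^T\xi_i=0$; the preconditioned metric is $\langle\xi,\eta\rangle_U=\sum_i\langle\xi_i,\eta_i\rangle_U$, with $\langle\xi_i,\eta_i\rangle_U=\mathrm{tr}(\xi_i^T\eta_i\lambda_i)$. Let $\mathcal M^\circ$ be the set of the points at which it is positive definite (all $\lambda_i$ are positive definite). On $\mathcal M^\circ$ the Riemannian gradient of $f$ has the blocks $\nabla_if(U)=U_i-Y_{(i)}Y_{(i)}^TU_i\lambda_i^{-1}$,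 and $\|\nabla f(U)\|_U=\big(\sum_i\|\nabla_if(U)\|_U^2\big)^{1/2}$. The retraction $\mathcal R_{U_i}(\nu)$ is an orthonormal basis of the column space of $U_i+\nu$ (for instance its $Q$-factor), and $\mathcal R_U(\xi)=(\mathcal R_{U_i}(\xi_i))_i$. RPCD with step sizes $\alpha_1,\dots,\alpha_d$: given $x^t$, put $y^{t,0}=x^t$; for $k=1,\dots,d$ obtain $y^{t,k}$ from $y^{t,k-1}$ by replacing its $k$-th factor $U_k$ by $\mathcal R_{U_k}(-\alpha_k\nabla_kf(y^{t,k-1}))$; put $x^{t+1}=y^{t,d}$. Constants on a set $D\subseteq\mathcal M^\circ$: (a) $L_1,\dots,L_d>0$ are \emph{block Lipschitz constants} on $D$ if for all $U\in D$, all $i$ and all $\nu$ with $U_i^T\nu=0$, with $\nu$ also regarded as a tangent vector in the $i$-th block, $f(\mathcal R_U(\nu))\le f(U)+\langle\nabla_i f(U),\nu\rangle_U+\frac{L_i}2\|\nu\|_U^2$. (b) An \emph{isometric vector transport} $\mathcal T$ on $D$ is a family of linear maps $\mathcal T_V^U$ ($U,V\in D$) from the tangent space at $V$ to that at $U$ which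 act factor by factor, are isometric on each factor, and satisfy $\mathcal T_U^U=\mathrm{id}$. (c) $L_{RL}>0$ is a \emph{Lipschitz constant of $\nabla f$ along retractions} on $D$ with respect to $\mathcal T$ if $$\|\nabla f(U)-\mathcal T_V^U\nabla f(V)\|_U\le L_{RL}\Big(\sum_{j=1}^d\|\xi_j\|_{W^j}^2\Big)^{1/2}$$ for all $U\in D$ and all tangent vectors $\xi$ at $U$ for which $V=\mathcal R_U(\xi)$ and all $W^j=(V_1,\dots,V_{j-1},U_j,\dots,U_d)$ lie in $D$. (So the component $\xi_j$ is measured at the point $W^j$ where the $j$-th factor moves when the factors are moved one after another; the metric of a factor depends on the other factors.) \textbf{Claim.} 1. There are block Lipschitz constants on $\mathcal M^\circ$. 2. On every compact $D\subseteq\mathcal M^\circ$ there are an isometric vector transport $\mathcal T$ and a constant $L_{RL}$ as in (c). 3. Let $D\subseteq\mathcal M^\circ$, let $L_1,\dots,L_d$ be block Lipschitz constants on $D$, $\mathcal T$ an isometric vector transport on $D$, and $L_{RL}$ as in (c). Put $L_{\min}=\min_iL_i$, $L_{\max}=\max_iL_i$ and $C=L_{RL}^2/L_{\min}^2$. Then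 for every RPCD sequence with $\alpha_i=1/L_i$ all of whose points $y^{t,k}$ lie in $D$, $\|\nabla f(x^t)\|_{x^t}^2\to0$ and, for all $t\ge1$, $$\min_{1\le i\le t}\|\nabla f(x^{i-1})\|_{x^{i-1}}\le\sqrt{\big(f(x^0)-f(x^t)\big)\,4L_{\max}(1+Cd)/t}\,.$$ In particular the factor $m-1=d-1$ in the constant $C=(m-1)L_{RL}^2/L_{\min}^2$ of tangent subspace descent on general manifolds is absent. -/

import Mathlib

open Filter Topology

namespace Tucker

/-- A real tensor of order `d` and size `n 0 × ⋯ × n (d-1)`. -/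
abbrev Tensor {d : ℕ} (n : Fin d → ℕ) := ((i : Fin d) → Fin (n i)) → ℝ

/-- A tuple of `d` matrices, the `i`-th of size `n i × r i`. It is used both for tuples of factor
matrices and for tuples of tangent vectors. -/
abbrev Factors {d : ℕ} (n r : Fin d → ℕ) := (i : Fin d) → Matrix (Fin (n i)) (Fin (r i)) ℝ

/-- The tuples of factor matrices with orthonormal columns. A point of the product of the
Grassmann manifolds `Gr (n i) (r i)` is represented by any such tuple whose columns span the given
subspaces. -/
def orthonormalFactors {d : ℕ} (n r : Fin d → ℕ) : Set (Factors n r) :=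
  {U | ∀ i, (U i).transpose * U i = 1}

/-- The core tensor `X ×₁ U₁ᵀ ×₂ ⋯ ×_d U_dᵀ`. -/
def core {d : ℕ} {n r : Fin d → ℕ} (X : Tensor n) (U : Factors n r) : Tensor r :=
  fun k => ∑ p : (i : Fin d) → Fin (n i), X p * ∏ i, U i (p i) (k i)

/-- The cost `f(U) = -½ ‖X ×₁ U₁ᵀ ×₂ ⋯ ×_d U_dᵀ‖_F²`. -/
noncomputable def cost {d : ℕ} {n r : Fin d → ℕ} (X : Tensor n) (U : Factors n r) : ℝ :=
  -(1 / 2) * ∑ k, core X U k ^ 2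

/-- The mode-`i` unfolding `Y₍ᵢ₎` of `Yᵢ = X ×₋ᵢ {Uᵀ}` (all modes but the `i`-th are
contracted with the factor matrices). -/
def unfolding {d : ℕ} {n r : Fin d → ℕ} (X : Tensor n) (U : Factors n r) (i : Fin d) :
    Matrix (Fin (n i)) ((j : {j : Fin d // j ≠ i}) → Fin (r j)) ℝ :=
  fun a k => ∑ p : (i : Fin d) → Fin (n i),
    if p i = a then X p * ∏ j : {j : Fin d // j ≠ i}, U j (p j) (k j) else 0

/-- The preconditioner `λᵢ = Uᵢᵀ Y₍ᵢ₎ Y₍ᵢ₎ᵀ Uᵢ`. -/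
def precond {d : ℕ} {n r : Fin d → ℕ} (X : Tensor n) (U : Factors n r) (i : Fin d) :
    Matrix (Fin (r i)) (Fin (r i)) ℝ :=
  (U i).transpose * (unfolding X U i * (unfolding X U i).transpose) * U i

/-- The points at which the preconditioned metric is positive definite. -/
def regularPoints {d : ℕ} {n r : Fin d → ℕ} (X : Tensor n) : Set (Factors n r) :=
  {U | U ∈ orthonormalFactors n r ∧ ∀ i, (precond X U i).PosDef}

/-- The horizontal lift of the tangent space of `Gr (n, r)` at the column space of `U`. -/
def IsHorizontal {n r : ℕ} (U ξ : Matrix (Fin n) (Fin r) ℝ) : Prop :=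
  U.transpose * ξ = 0

/-- The preconditioned metric on the `i`-th block, `⟨ξ, η⟩ = ⟨ξ, η λᵢ⟩_F`. -/
def blockInner {d : ℕ} {n r : Fin d → ℕ} (X : Tensor n) (U : Factors n r) (i : Fin d)
    (ξ η : Matrix (Fin (n i)) (Fin (r i)) ℝ) : ℝ :=
  (ξ.transpose * (η * precond X U i)).trace

/-- The norm of a tuple of tangent vectors at `U`, `(∑ᵢ ‖ξᵢ‖²)^(1/2)`. -/
noncomputable def tangentNorm {d : ℕ} {n r : Fin d → ℕ} (X : Tensor n) (U : Factors n r)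
    (ξ : Factors n r) : ℝ :=
  Real.sqrt (∑ i, blockInner X U i (ξ i) (ξ i))

/-- The `i`-th block of the Riemannian gradient of the cost for the preconditioned metric,
`Uᵢ - Y₍ᵢ₎ Y₍ᵢ₎ᵀ Uᵢ λᵢ⁻¹`. -/
noncomputable def grad {d : ℕ} {n r : Fin d → ℕ} (X : Tensor n) (U : Factors n r) : Factors n r :=
  fun i => U i - unfolding X U i * (unfolding X U i).transpose * U i * (precond X U i)⁻¹

/-- The gradient is a horizontal vector. -/
theorem isHorizontal_grad {d : ℕ} {n r : Fin d → ℕ} (X : Tensor n) {U : Factors n r}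
    (hU : U ∈ regularPoints X) (i : Fin d) : IsHorizontal (U i) (grad X U i) := by
  have h1 : (U i).transpose * U i = 1 := hU.1 i
  have h2 : IsUnit (precond X U i).det := (Matrix.isUnit_iff_isUnit_det _).1 (hU.2 i).isUnit
  have h3 : (U i).transpose * (unfolding X U i * (unfolding X U i).transpose * U i *
      (precond X U i)⁻¹) = precond X U i * (precond X U i)⁻¹ := by
    simp only [precond, Matrix.mul_assoc]
  unfold IsHorizontal grad
  rw [Matrix.mul_sub, h1, h3, Matrix.mul_nonsing_inv _ h2, sub_self]

/-- The gradient represents the differential of the cost, whose `i`-th Euclidean partial gradient is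
`-Y₍ᵢ₎ Y₍ᵢ₎ᵀ Uᵢ`, with respect to the preconditioned metric. -/
theorem blockInner_grad {d : ℕ} {n r : Fin d → ℕ} (X : Tensor n) {U : Factors n r}
    (hU : U ∈ regularPoints X) (i : Fin d) (ξ : Matrix (Fin (n i)) (Fin (r i)) ℝ)
    (hξ : IsHorizontal (U i) ξ) :
    blockInner X U i (grad X U i) ξ =
      ((-(unfolding X U i * (unfolding X U i).transpose * U i)).transpose * ξ).trace := by
  have h2 : IsUnit (precond X U i).det := (Matrix.isUnit_iff_isUnit_det _).1 (hU.2 i).isUnit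
  have h4 : (precond X U i).transpose = precond X U i := by
    simp [precond, Matrix.mul_assoc]
  unfold IsHorizontal at hξ
  unfold blockInner grad
  rw [Matrix.transpose_sub, Matrix.sub_mul, ← Matrix.mul_assoc, hξ, Matrix.zero_mul, zero_sub,
    Matrix.transpose_mul, Matrix.transpose_nonsing_inv, h4, Matrix.trace_neg, Matrix.mul_assoc,
    Matrix.trace_mul_comm, Matrix.mul_assoc, Matrix.mul_nonsing_inv_cancel_right _ _ h2,
    Matrix.transpose_neg, Matrix.neg_mul, Matrix.trace_neg]

/-- `V` represents the retraction of the horizontal vector `ν` at `U`: its columns are an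
orthonormal basis of the column space of `U + ν` (for instance, the `Q`-factor of `U + ν`). -/
def IsRetraction {n r : ℕ} (U ν V : Matrix (Fin n) (Fin r) ℝ) : Prop :=
  V.transpose * V = 1 ∧ ∃ G : Matrix (Fin r) (Fin r) ℝ, U + ν = V * G

/-- `L i` is a Lipschitz constant of the `i`-th block: on `D`, the cost satisfies the restricted
Lipschitz-type inequality for the pull-back along the `i`-th block. -/
def IsBlockLipschitz {d : ℕ} {n r : Fin d → ℕ} (X : Tensor n) (D : Set (Factors n r))
    (L : Fin d → ℝ) : Prop :=
  ∀ U ∈ D, ∀ i, ∀ ν V : Matrix (Fin (n i)) (Fin (r i)) ℝ,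
    IsHorizontal (U i) ν → IsRetraction (U i) ν V →
      cost X (Function.update U i V) ≤
        cost X U + blockInner X U i (grad X U i) ν + L i / 2 * blockInner X U i ν ν

/-- `T U V` transports tangent vectors at `U` to tangent vectors at `V`, factor by factor, linearly
and isometrically. -/
structure IsIsometricTransport {d : ℕ} {n r : Fin d → ℕ} (X : Tensor n) (D : Set (Factors n r))
    (T : Factors n r → Factors n r → (i : Fin d) →
      Matrix (Fin (n i)) (Fin (r i)) ℝ →ₗ[ℝ] Matrix (Fin (n i)) (Fin (r i)) ℝ) : Prop where
  horizontal : ∀ U ∈ D, ∀ V ∈ D, ∀ i ξ, IsHorizontal (U i) ξ → IsHorizontal (V i) (T U V i ξ)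
  isometry : ∀ U ∈ D, ∀ V ∈ D, ∀ i ξ, IsHorizontal (U i) ξ →
    blockInner X V i (T U V i ξ) (T U V i ξ) = blockInner X U i ξ ξ
  self : ∀ U ∈ D, ∀ i ξ, IsHorizontal (U i) ξ → T U U i ξ = ξ

/-- The point on the way from `U` to `V` at which the factors before the `j`-th are
already those of `V`. -/
def mix {d : ℕ} {n r : Fin d → ℕ} (U V : Factors n r) (j : Fin d) : Factors n r :=
  fun i => if i < j then V i else U i

/-- The norm of the displacement `ξ` from `U` to `V`, the `j`-th component being measured in the
metric at the point where the `j`-th factor is moved, when the factors are moved one after another.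
(The metric of one factor depends on the other factors.) -/
noncomputable def displacementNorm {d : ℕ} {n r : Fin d → ℕ} (X : Tensor n) (U V : Factors n r)
    (ξ : Factors n r) : ℝ :=
  Real.sqrt (∑ j, blockInner X (mix U V j) j (ξ j) (ξ j))

/-- `K` is a Lipschitz constant, on `D`, of the gradient of the cost along retractions, with respect
to the vector transport `T`: `‖∇f(U) - T ∇f(V)‖_U ≤ K ‖ξ‖` whenever `V` is the retraction of `ξ`
at `U`. -/
def IsRetractionLipschitz {d : ℕ} {n r : Fin d → ℕ} (X : Tensor n) (D : Set (Factors n r))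
    (T : Factors n r → Factors n r → (i : Fin d) →
      Matrix (Fin (n i)) (Fin (r i)) ℝ →ₗ[ℝ] Matrix (Fin (n i)) (Fin (r i)) ℝ) (K : ℝ) : Prop :=
  ∀ U ∈ D, ∀ V ∈ D, (∀ j, mix U V j ∈ D) → ∀ ξ : Factors n r,
    (∀ i, IsHorizontal (U i) (ξ i)) → (∀ i, IsRetraction (U i) (ξ i) (V i)) →
      tangentNorm X U (fun i => grad X U i - T V U i (grad X V i)) ≤
        K * displacementNorm X U V ξ

/-- `y t k` is the point reached in the outer iteration `t` after the first `k` inner iterations of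
Riemannian preconditioned coordinate descent with step size `α i` for the `i`-th factor. -/
structure IsRPCD {d : ℕ} {n r : Fin d → ℕ} (X : Tensor n) (α : Fin d → ℝ)
    (y : ℕ → Fin (d + 1) → Factors n r) : Prop where
  outer : ∀ t, y (t + 1) 0 = y t (Fin.last d)
  fixed : ∀ t (k j : Fin d), j ≠ k → y t k.succ j = y t k.castSucc j
  step : ∀ t (k : Fin d),
    IsRetraction (y t k.castSucc k) (-(α k • grad X (y t k.castSucc) k)) (y t k.succ k)

end Tucker

/-!
The cost along the `i`-th factor is `-½ ‖Yᵀ V‖²`, where `Y = Y₍ᵢ₎` does not involve that factor,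
and all three claims rest on this quadratic form.

*Block constants.* If `U + ν = V G` with `ν` horizontal, then `Gᵀ G = 1 + νᵀ ν`, and the required
inequality with `Lᵢ = 1` follows from `0 ≤ ‖Yᵀ V - Yᵀ U Gᵀ‖²` (`isBlockLipschitz_one`).

*Transport.* Given frames `U` and `V`, the polar decomposition (`exists_polar`) provides an
orthogonal `Q` such that `Uᵀ V Q` is positive semidefinite. There is then a rational formula for an
orthogonal matrix `O` with `O V Q = U` (`rotation`), and, with `M` the square root of the
preconditioner, `η ↦ O η M_V Q M_U⁻¹` is an isometry from the horizontal space at `V` to that at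
`U` (`transport`). If `V` is a retraction of `ξ` at `U`, then `V Q - U` and `O - 1` are of the
order of `‖ξ‖` (`norm_sub_le_of_polar`, `norm_rotation_sub_one_le`). On a compact set of regular
points `M⁻¹` is bounded, hence `M` and `M⁻¹` depend on `Uᵀ Y Yᵀ U` in a Lipschitz way
(`norm_sub_le_mul_norm_mul_self_sub`), and so does the gradient
(`exists_isRetractionLipschitz_transport`). The matrix `Y Yᵀ` does not see the change of basis `Q`
(`unfolding_mul_transpose_eq`). The same bound on `M⁻¹` compares the Frobenius norm of `ξ` with its
displacement norm.

*Rate.* With step sizes `1 / Lᵢ`, the `k`-th inner iteration decreases the cost by at least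
`‖∇ₖf(y^{t,k-1})‖² / (2 Lₖ)`. The point `y^{t,k-1}` is the retraction at `x^t` of the steps taken
so far, and the points where `displacementNorm` measures their components are the iterates at which
they were computed (`IsRPCD.mix_eq`). So `‖∇ₖf(x^t)‖²` is at most `2 ‖∇ₖf(y^{t,k-1})‖²` plus `2
L_RL² / L_min²` times the sum of the squares of these steps' gradients
(`IsRPCD.tangentNorm_grad_sub_sq_le`). No factor `d - 1` arises in this comparison; the factor `d`
comes from summing it over the blocks (`IsRPCD.tangentNorm_grad_sq_le`). The resulting inequality
telescopes, and the cost is bounded below.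
-/

namespace Tucker

open Matrix

open scoped MatrixOrder

/-! ### Square roots and the polar decomposition -/

section Polar

variable {n : Type*} [Fintype n] [DecidableEq n]

theorem transpose_sqrt (A : Matrix n n ℝ) : (CFC.sqrt A)ᵀ = CFC.sqrt A := by
  simpa [conjTranspose_eq_transpose_of_trivial] using
    (CFC.sqrt_nonneg A).posSemidef.isHermitian.eq

theorem sqrt_mul_self {A : Matrix n n ℝ} (hA : A.PosSemidef) : CFC.sqrt A * CFC.sqrt A = A :=
  CFC.sqrt_mul_sqrt_self A hA.nonneg

theorem posDef_sqrt {A : Matrix n n ℝ} (hA : A.PosDef) : (CFC.sqrt A).PosDef := by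
  have h := sqrt_mul_self hA.posSemidef
  refine ((CFC.sqrt_nonneg A).posSemidef.posDef_iff_isUnit).2 ?_
  have := hA.isUnit
  rw [← h, isUnit_iff_isUnit_det, det_mul] at this
  exact (isUnit_iff_isUnit_det _).2 (isUnit_of_mul_isUnit_left this)

theorem exists_polar_of_isUnit {B : Matrix n n ℝ} (hB : IsUnit B) :
    ∃ Q : Matrix n n ℝ, Qᵀ * Q = 1 ∧ (B * Q).PosSemidef := by
  have hS : (B * Bᵀ).PosSemidef := by
    simpa [conjTranspose_eq_transpose_of_trivial] using posSemidef_self_mul_conjTranspose B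
  have hu : IsUnit B.det := (isUnit_iff_isUnit_det _).1 hB
  refine ⟨B⁻¹ * CFC.sqrt (B * Bᵀ), ?_, ?_⟩
  · refine mul_eq_one_comm.1 ?_
    rw [transpose_mul, transpose_sqrt, Matrix.mul_assoc, ← Matrix.mul_assoc (CFC.sqrt _),
      sqrt_mul_self hS, transpose_nonsing_inv, Matrix.mul_assoc B,
      mul_nonsing_inv _ (by rwa [det_transpose]), Matrix.mul_one, nonsing_inv_mul _ hu]
  · rw [mul_nonsing_inv_cancel_left _ _ hu]
    exact (CFC.sqrt_nonneg _).posSemidef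

theorem abs_le_one_of_transpose_mul_self {m n : Type*} [Fintype m] [DecidableEq n]
    {U : Matrix m n ℝ} (hU : Uᵀ * U = 1) (a : m) (b : n) : |U a b| ≤ 1 := by
  have h1 : ∑ i, U i b ^ 2 = 1 := by
    have := congr_fun (congr_fun hU b) b
    rw [Matrix.mul_apply, Matrix.one_apply_eq] at this
    simpa [pow_two] using this
  rw [← sq_le_one_iff_abs_le_one, ← h1]
  exact Finset.single_le_sum (f := fun i => U i b ^ 2) (fun i _ => sq_nonneg _) (Finset.mem_univ a)

theorem isCompact_setOf_transpose_mul_self : IsCompact {Q : Matrix n n ℝ | Qᵀ * Q = 1} := by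
  have hK : IsCompact (Set.univ.pi fun _ => Set.univ.pi fun _ => Set.Icc (-1) 1 :
      Set (n → n → ℝ)) :=
    isCompact_univ_pi fun _ => isCompact_univ_pi fun _ => isCompact_Icc
  refine IsCompact.of_isClosed_subset hK ?_ ?_
  · exact isClosed_eq (by fun_prop) continuous_const
  · intro Q hQ a _ b _
    exact abs_le.1 (abs_le_one_of_transpose_mul_self hQ a b)

theorem isClosed_setOf_posSemidef {n : Type*} [Fintype n] :
    IsClosed {C : Matrix n n ℝ | C.PosSemidef} := by
  have : {C : Matrix n n ℝ | C.PosSemidef} =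
      {C | Cᴴ = C} ∩ ⋂ x : n → ℝ, {C | 0 ≤ star x ⬝ᵥ (C *ᵥ x)} := by
    ext C
    simp [posSemidef_iff_dotProduct_mulVec, IsHermitian]
  rw [this]
  refine IsClosed.inter (isClosed_eq (by fun_prop) continuous_id) (isClosed_iInter fun x => ?_)
  exact isClosed_le continuous_const (by fun_prop)

/-- The polar decomposition. The invertible case passes to the limit, as the orthogonal group is
compact and invertible matrices are dense. -/
theorem exists_polar (B : Matrix n n ℝ) :
    ∃ Q : Matrix n n ℝ, Qᵀ * Q = 1 ∧ (B * Q).PosSemidef := by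
  let K := {Q : Matrix n n ℝ | Qᵀ * Q = 1}
  have : CompactSpace K := isCompact_iff_compactSpace.1 isCompact_setOf_transpose_mul_self
  let F : Set (Matrix n n ℝ × K) := {x | (x.1 * x.2.1).PosSemidef}
  have hF : IsClosed F := isClosed_setOf_posSemidef.preimage
    (f := fun x : Matrix n n ℝ × K => x.1 * x.2.1) (by fun_prop)
  have hS : IsClosed (Prod.fst '' F) := isClosedMap_fst_of_compactSpace _ hF
  have hB : B ∈ Prod.fst '' F := by
    have ht : Tendsto (fun ε : ℝ => B + ε • (1 : Matrix n n ℝ)) (𝓝[≠] 0) (𝓝 B) := by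
      have : Continuous fun ε : ℝ => B + ε • (1 : Matrix n n ℝ) := by fun_prop
      simpa using (this.tendsto 0).mono_left nhdsWithin_le_nhds
    refine hS.mem_of_tendsto ht ?_
    have hfin := Polynomial.finite_setOfPred_isRoot (charpoly_monic (-B)).ne_zero
    filter_upwards [nhdsNE_le_cofinite 0 hfin.compl_mem_cofinite] with ε hε
    have hu : IsUnit (B + ε • (1 : Matrix n n ℝ)) := by
      rw [isUnit_iff_isUnit_det, isUnit_iff_ne_zero]
      intro h0
      refine hε ?_
      rw [Set.mem_ofPred_eq, Polynomial.IsRoot.def, eval_charpoly, ← h0]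
      congr 1
      rw [sub_neg_eq_add, add_comm, scalar_apply, smul_one_eq_diagonal]
    obtain ⟨Q, hQ, hP⟩ := exists_polar_of_isUnit hu
    exact ⟨(_, ⟨Q, hQ⟩), hP, rfl⟩
  obtain ⟨⟨_, Q⟩, hP, rfl⟩ := hB
  exact ⟨Q.1, Q.2, hP⟩

end Polar

/-! ### Bounds on compact sets of regular points -/

section Compact

variable {d : ℕ} {n r : Fin d → ℕ} (X : Tensor n)

theorem continuous_precond (i : Fin d) : Continuous fun U : Factors n r => precond X U i := by
  have h : Continuous fun U : Factors n r => unfolding X U i := by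
    refine continuous_matrix fun a k => ?_
    simp only [unfolding]
    refine continuous_finsetSum _ fun p _ => ?_
    split_ifs
    · exact continuous_const.mul (continuous_finsetProd _ fun j _ =>
        (continuous_apply j.1).matrix_elem _ _)
    · exact continuous_const
  have hU : Continuous fun U : Factors n r => U i := continuous_apply i
  exact (hU.matrix_transpose.matrix_mul (h.matrix_mul h.matrix_transpose)).matrix_mul hU

theorem exists_trace_inv_precond_le {D : Set (Factors n r)} (hD : D ⊆ regularPoints X)
    (hc : IsCompact D) : ∃ b : ℝ, 0 ≤ b ∧ ∀ U ∈ D, ∀ i, (precond X U i)⁻¹.trace ≤ b := by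
  have h (i : Fin d) : ∃ b : ℝ, ∀ U ∈ D, (precond X U i)⁻¹.trace ≤ b := by
    have hcont : ContinuousOn (fun U => (precond X U i)⁻¹.trace) D := by
      intro U hU
      refine ContinuousAt.continuousWithinAt ?_
      have hu : (precond X U i).det ≠ 0 := ((hD hU).2 i).det_pos.ne'
      have h1 : ContinuousAt (fun U => (precond X U i)⁻¹) U := by
        refine ContinuousAt.comp (g := Inv.inv) (continuousAt_matrix_inv _ ?_)
          (continuous_precond X i).continuousAt
        rw [Ring.inverse_eq_inv']
        exact continuousAt_inv₀ hu
      exact (continuous_id.matrix_trace).continuousAt.comp h1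
    obtain ⟨b, hb⟩ := hc.bddAbove_image hcont
    exact ⟨b, fun U hU => hb ⟨U, hU, rfl⟩⟩
  choose b hb using h
  exact ⟨∑ i, |b i|, by positivity, fun U hU i => (hb i U hU).trans ((le_abs_self _).trans
    (Finset.single_le_sum (f := fun i => |b i|) (fun _ _ => abs_nonneg _) (Finset.mem_univ i)))⟩

end Compact

/-! ### The Frobenius norm -/

open scoped Matrix.Norms.Frobenius

section Frobenius

variable {l m n : Type*} [Fintype l] [Fintype m] [Fintype n]

theorem frobenius_norm_sq (A : Matrix m n ℝ) : ‖A‖ ^ 2 = (Aᵀ * A).trace := by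
  have h : 0 ≤ ∑ i, ∑ j, ‖A i j‖ ^ (2 : ℝ) := by positivity
  rw [frobenius_norm_def, ← Real.sqrt_eq_rpow, Real.sq_sqrt h, Finset.sum_comm]
  simp [Matrix.trace, Matrix.mul_apply, pow_two]

theorem frobenius_norm_sq' (A : Matrix m n ℝ) : ‖A‖ ^ 2 = (A * Aᵀ).trace := by
  rw [frobenius_norm_sq, trace_mul_comm]

theorem frobenius_norm_sq_eq_sum (A : Matrix m n ℝ) : ‖A‖ ^ 2 = ∑ i, ∑ j, A i j ^ 2 := by
  rw [frobenius_norm_sq']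
  simp [Matrix.trace, Matrix.mul_apply, pow_two]

theorem frobenius_norm_le_sum (A : Matrix m n ℝ) : ‖A‖ ≤ ∑ i, ∑ j, |A i j| := by
  refine le_of_sq_le_sq ?_ (by positivity)
  rw [frobenius_norm_sq_eq_sum, ← Fintype.sum_prod_type' (fun i j => A i j ^ 2),
    ← Fintype.sum_prod_type' (fun i j => |A i j|)]
  simp_rw [← sq_abs (A _ _)]
  exact Finset.sum_sq_le_sq_sum_of_nonneg fun _ _ => abs_nonneg _

/-- The Cauchy–Schwarz inequality for the Frobenius inner product. -/
theorem trace_transpose_mul_le (A B : Matrix m n ℝ) : (Aᵀ * B).trace ≤ ‖A‖ * ‖B‖ := by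
  have h : (Aᵀ * B).trace = ∑ x : n × m, A x.2 x.1 * B x.2 x.1 := by
    simp [Matrix.trace, Matrix.mul_apply, Fintype.sum_prod_type]
  have h1 (A : Matrix m n ℝ) : ‖A‖ = √(∑ x : n × m, A x.2 x.1 ^ 2) := by
    rw [← Real.sqrt_sq (norm_nonneg A), frobenius_norm_sq_eq_sum, Fintype.sum_prod_type,
      Finset.sum_comm]
  rw [h, h1, h1]
  exact Real.sum_mul_le_sqrt_mul_sqrt _ _ _

theorem norm_mul_of_transpose_mul_self [DecidableEq m] {Q : Matrix l m ℝ} (hQ : Qᵀ * Q = 1)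
    (A : Matrix m n ℝ) : ‖Q * A‖ = ‖A‖ := by
  refine (sq_eq_sq₀ (norm_nonneg _) (norm_nonneg _)).1 ?_
  rw [frobenius_norm_sq, frobenius_norm_sq, transpose_mul, Matrix.mul_assoc, ← Matrix.mul_assoc Qᵀ,
    hQ, Matrix.one_mul]

theorem norm_mul_of_mul_transpose_self [DecidableEq m] {Q : Matrix m l ℝ} (hQ : Q * Qᵀ = 1)
    (A : Matrix n m ℝ) : ‖A * Q‖ = ‖A‖ := by
  rw [← frobenius_norm_transpose, transpose_mul,
    norm_mul_of_transpose_mul_self (by rwa [transpose_transpose]), frobenius_norm_transpose]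

theorem norm_sq_of_transpose_mul_self [DecidableEq n] {U : Matrix m n ℝ} (hU : Uᵀ * U = 1) :
    ‖U‖ ^ 2 = Fintype.card n := by
  rw [frobenius_norm_sq, hU, trace_one]

theorem trace_mul_mul_transpose_nonneg {C : Matrix n n ℝ} (hC : C.PosSemidef)
    (X : Matrix m n ℝ) : 0 ≤ (X * C * Xᵀ).trace := by
  have := (hC.mul_mul_conjTranspose_same X).trace_nonneg
  rwa [conjTranspose_eq_transpose_of_trivial] at this

/-- Right multiplication by `1 + C`, with `C` positive semidefinite, is expanding. -/
theorem norm_le_norm_mul_one_add [DecidableEq n] {C : Matrix n n ℝ} (hC : C.PosSemidef)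
    (X : Matrix m n ℝ) : ‖X‖ ≤ ‖X * (1 + C)‖ := by
  refine le_of_sq_le_sq ?_ (norm_nonneg _)
  have hCt : Cᵀ = C := by
    simpa [conjTranspose_eq_transpose_of_trivial] using hC.isHermitian.eq
  have h1 := trace_mul_mul_transpose_nonneg hC X
  have h2 : ‖X * (1 + C)‖ ^ 2 = ‖X‖ ^ 2 + 2 * (X * C * Xᵀ).trace + ‖X * C‖ ^ 2 := by
    simp only [frobenius_norm_sq', Matrix.mul_add, Matrix.mul_one, Matrix.add_mul, transpose_add,
      trace_add, transpose_mul, hCt, Matrix.mul_assoc]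
    ring
  rw [h2]
  nlinarith [sq_nonneg ‖X * C‖]

/-- A lower bound for the quadratic form of `M` by the norm of `M⁻¹`, in place of one by the least
eigenvalue. -/
theorem norm_sq_le_mul_trace [DecidableEq n] {M : Matrix n n ℝ} (hM : M.PosDef) {c : ℝ}
    (hc : ‖M⁻¹‖ ≤ c) (X : Matrix m n ℝ) : ‖X‖ ^ 2 ≤ c * (X * M * Xᵀ).trace := by
  have hMt : Mᵀ = M := by
    simpa [conjTranspose_eq_transpose_of_trivial] using hM.isHermitian.eq
  have hMu : IsUnit M.det := (isUnit_iff_isUnit_det _).1 hM.isUnit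
  have hX := trace_mul_mul_transpose_nonneg hM.posSemidef X
  have hW : (X * M⁻¹ * Xᵀ).trace ≤ c * ‖X‖ ^ 2 := by
    have h1 := trace_transpose_mul_le Xᵀ (M⁻¹ * Xᵀ)
    rw [transpose_transpose, ← Matrix.mul_assoc, frobenius_norm_transpose] at h1
    have h2 := frobenius_norm_mul M⁻¹ Xᵀ
    rw [frobenius_norm_transpose] at h2
    nlinarith [norm_nonneg X]
  -- the form of `M` is nonnegative at `c • X - X * M⁻¹`
  have hP := trace_mul_mul_transpose_nonneg hM.posSemidef (c • X - X * M⁻¹)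
  have h3 : ((c • X - X * M⁻¹) * M * (c • X - X * M⁻¹)ᵀ).trace =
      c ^ 2 * (X * M * Xᵀ).trace - 2 * c * ‖X‖ ^ 2 + (X * M⁻¹ * Xᵀ).trace := by
    simp only [Matrix.sub_mul, transpose_sub, Matrix.mul_sub, trace_sub, transpose_mul,
      transpose_smul, Matrix.smul_mul, Matrix.mul_smul, trace_smul, smul_eq_mul,
      transpose_nonsing_inv, hMt, nonsing_inv_mul_cancel_right _ _ hMu, frobenius_norm_sq']
    simp only [Matrix.mul_assoc, mul_nonsing_inv_cancel_left _ _ hMu]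
    ring
  rw [h3] at hP
  rcases (norm_nonneg M⁻¹ |>.trans hc).eq_or_lt with h0 | h0
  · have h4 : ‖M⁻¹‖ = 0 := le_antisymm (h0 ▸ hc) (norm_nonneg _)
    rw [norm_eq_zero] at h4
    have h5 : X = 0 := by
      rw [← nonsing_inv_mul_cancel_right M X hMu, h4, Matrix.mul_zero, Matrix.zero_mul]
    simp [h5]
  · have h5 : c * ‖X‖ ^ 2 ≤ c * (c * (X * M * Xᵀ).trace) := by nlinarith
    exact le_of_mul_le_mul_left h5 h0

/-- The square root is Lipschitz away from singular matrices: with `X = M - N`, the inner product of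
`X` and `M² - N²` is `tr (X M X) + tr (X N X)`. -/
theorem norm_sub_le_mul_norm_mul_self_sub [DecidableEq n] {M N : Matrix n n ℝ} (hM : M.PosDef)
    (hN : N.PosSemidef) {c : ℝ} (hc : ‖M⁻¹‖ ≤ c) : ‖M - N‖ ≤ c * ‖M * M - N * N‖ := by
  have hMt : Mᵀ = M := by
    simpa [conjTranspose_eq_transpose_of_trivial] using hM.isHermitian.eq
  have hNt : Nᵀ = N := by
    simpa [conjTranspose_eq_transpose_of_trivial] using hN.isHermitian.eq
  have hXt : (M - N)ᵀ = M - N := by rw [transpose_sub, hMt, hNt]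
  have h1 := norm_sq_le_mul_trace hM hc (M - N)
  have h2 := trace_mul_mul_transpose_nonneg hN (M - N)
  rw [hXt] at h1 h2
  have h3 : ((M - N)ᵀ * (M * M - N * N)).trace =
      ((M - N) * M * (M - N)).trace + ((M - N) * N * (M - N)).trace := by
    have : M * M - N * N = M * (M - N) + (M - N) * N := by noncomm_ring
    rw [hXt, this, Matrix.mul_add, trace_add, ← Matrix.mul_assoc, trace_mul_comm _ ((M - N) * N)]
  have h4 := trace_transpose_mul_le (M - N) (M * M - N * N)
  have hc0 : 0 ≤ c := (norm_nonneg _).trans hc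
  by_contra! h5
  have h6 : 0 < ‖M - N‖ := lt_of_le_of_lt (by positivity) h5
  have h7 : ‖M - N‖ ^ 2 ≤ c * (‖M - N‖ * ‖M * M - N * N‖) :=
    h1.trans (mul_le_mul_of_nonneg_left (by linarith) hc0)
  nlinarith

end Frobenius

/-! ### The direct rotation between two subspaces -/

section Rotation

variable {m n : Type*} [Fintype m] [Fintype n] [DecidableEq n]

/-- The direct rotation that takes the orthonormal frame `W` to the orthonormal frame `U`, given by
a rational formula. It is orthogonal when `Uᵀ * W` is positive semidefinite; then `1 + Uᵀ * W` is
invertible even when the two subspaces are far apart. -/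
noncomputable def rotation [DecidableEq m] (U W : Matrix m n ℝ) : Matrix m m ℝ :=
  1 - (U + W) * (1 + Uᵀ * W)⁻¹ * (U + W)ᵀ + (2 : ℝ) • (U * Wᵀ)

theorem isUnit_det_one_add {C : Matrix n n ℝ} (hC : C.PosSemidef) : IsUnit (1 + C).det :=
  (isUnit_iff_isUnit_det _).1 (PosDef.one.add_posSemidef hC).isUnit

variable {U W : Matrix m n ℝ}

theorem transpose_mul_comm_of_posSemidef {m n : Type*} [Fintype m] {U W : Matrix m n ℝ}
    (hC : (Uᵀ * W).PosSemidef) : Wᵀ * U = Uᵀ * W := by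
  simpa [conjTranspose_eq_transpose_of_trivial] using hC.isHermitian.eq

theorem transpose_rotation [DecidableEq m] (hC : (Uᵀ * W).PosSemidef) :
    (rotation U W)ᵀ = 1 - (U + W) * (1 + Uᵀ * W)⁻¹ * (U + W)ᵀ + (2 : ℝ) • (W * Uᵀ) := by
  have h := transpose_mul_comm_of_posSemidef hC
  simp [rotation, transpose_sub, transpose_nonsing_inv, h, Matrix.mul_assoc]

theorem transpose_rotation_mul [DecidableEq m] (hU : Uᵀ * U = 1) (hC : (Uᵀ * W).PosSemidef) :
    (rotation U W)ᵀ * U = W := by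
  have hu := isUnit_det_one_add hC
  have h : (U + W)ᵀ * U = 1 + Uᵀ * W := by
    rw [transpose_add, Matrix.add_mul, hU, transpose_mul_comm_of_posSemidef hC]
  rw [transpose_rotation hC, Matrix.add_mul, Matrix.sub_mul, Matrix.one_mul,
    Matrix.mul_assoc _ (U + W)ᵀ, h, nonsing_inv_mul_cancel_right _ _ hu, Matrix.smul_mul,
    Matrix.mul_assoc, hU, Matrix.mul_one, two_smul]
  abel

theorem transpose_rotation_mul_rotation [DecidableEq m] (hU : Uᵀ * U = 1) (hW : Wᵀ * W = 1)
    (hC : (Uᵀ * W).PosSemidef) : (rotation U W)ᵀ * rotation U W = 1 := by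
  have hu := isUnit_det_one_add hC
  have h1 := transpose_rotation_mul hU hC
  have h2 : (rotation U W)ᵀ * (U + W) = (2 : ℝ) • (W * (1 + Uᵀ * W)) - (U + W) := by
    have h : (U + W)ᵀ * (U + W) = (2 : ℝ) • (1 + Uᵀ * W) := by
      rw [transpose_add, Matrix.add_mul, Matrix.mul_add, Matrix.mul_add, hU, hW,
        transpose_mul_comm_of_posSemidef hC, two_smul]
      abel
    have h' : Uᵀ * (U + W) = 1 + Uᵀ * W := by rw [Matrix.mul_add, hU]
    rw [transpose_rotation hC, Matrix.add_mul, Matrix.sub_mul, Matrix.one_mul,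
      Matrix.mul_assoc _ (U + W)ᵀ, h, Matrix.mul_smul, nonsing_inv_mul_cancel_right _ _ hu,
      Matrix.smul_mul, Matrix.mul_assoc, h', two_smul, two_smul]
    abel
  have h3 (P : Matrix m m ℝ) : P * rotation U W =
      P - P * (U + W) * (1 + Uᵀ * W)⁻¹ * (U + W)ᵀ + (2 : ℝ) • (P * U * Wᵀ) := by
    rw [rotation, Matrix.mul_add, Matrix.mul_sub, Matrix.mul_one, Matrix.mul_smul]
    simp only [Matrix.mul_assoc]
  rw [h3, h2, h1, Matrix.sub_mul, Matrix.smul_mul, mul_nonsing_inv_cancel_right _ _ hu,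
    transpose_rotation hC, transpose_add]
  simp only [Matrix.mul_add, Matrix.sub_mul, Matrix.add_mul, Matrix.smul_mul]
  abel

theorem norm_eq_sqrt_card (hU : Uᵀ * U = 1) : ‖U‖ = √(Fintype.card n) := by
  rw [← norm_sq_of_transpose_mul_self hU, Real.sqrt_sq (norm_nonneg _)]

theorem norm_one_eq_sqrt_card : ‖(1 : Matrix n n ℝ)‖ = √(Fintype.card n) :=
  norm_eq_sqrt_card (by simp)

theorem norm_inv_one_add_le {C : Matrix n n ℝ} (hC : C.PosSemidef) :
    ‖(1 + C)⁻¹‖ ≤ √(Fintype.card n) := by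
  have h := norm_le_norm_mul_one_add hC (1 + C)⁻¹
  rwa [nonsing_inv_mul _ (isUnit_det_one_add hC), norm_one_eq_sqrt_card] at h

theorem norm_rotation_sub_one_le [DecidableEq m] (hU : Uᵀ * U = 1) (hW : Wᵀ * W = 1)
    (hC : (Uᵀ * W).PosSemidef) :
    ‖rotation U W - 1‖ ≤
      (2 * √(Fintype.card n) + 2 * √(Fintype.card n) ^ 4) * ‖W - U‖ := by
  have hu := isUnit_det_one_add hC
  set s := √(Fintype.card n) with hs
  have hs0 : 0 ≤ s := Real.sqrt_nonneg _
  have hnU : ‖U‖ = s := norm_eq_sqrt_card hU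
  have hnW : ‖W‖ = s := norm_eq_sqrt_card hW
  have hK := norm_inv_one_add_le hC
  have hS : ‖U + W‖ ≤ 2 * s := (norm_add_le _ _).trans (by rw [hnU, hnW]; linarith)
  set K := (1 + Uᵀ * W)⁻¹ with hKd
  have h1 : (2 : ℝ) • K = 1 - K * (Uᵀ * (W - U)) := by
    have h : K * (1 + Uᵀ * W) = 1 := nonsing_inv_mul _ hu
    rw [Matrix.mul_add, Matrix.mul_one] at h
    rw [Matrix.mul_sub, hU, Matrix.mul_sub, Matrix.mul_one, ← h, two_smul]
    abel
  have h2 : (2 : ℝ) • (rotation U W - 1) = (2 : ℝ) • (U * (W - U)ᵀ) - (W - U) * (U + W)ᵀ +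
      (U + W) * (K * (Uᵀ * (W - U))) * (U + W)ᵀ := by
    have h3 : (U + W) * (K * (Uᵀ * (W - U))) * (U + W)ᵀ =
        (U + W) * (U + W)ᵀ - (2 : ℝ) • ((U + W) * K * (U + W)ᵀ) := by
      rw [show K * (Uᵀ * (W - U)) = 1 - (2 : ℝ) • K by rw [h1]; abel]
      simp [Matrix.mul_sub, Matrix.sub_mul]
    rw [h3, rotation, ← hKd]
    simp only [smul_sub, smul_add, two_smul, Matrix.mul_add, Matrix.add_mul, Matrix.sub_mul,
      Matrix.mul_sub, transpose_add, transpose_sub]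
    abel
  have h4 : ‖(2 : ℝ) • (U * (W - U)ᵀ)‖ ≤ 2 * (s * ‖W - U‖) := by
    rw [norm_smul, Real.norm_eq_abs, abs_two]
    have := frobenius_norm_mul U (W - U)ᵀ
    rw [frobenius_norm_transpose, hnU] at this
    linarith
  have h5 : ‖(W - U) * (U + W)ᵀ‖ ≤ ‖W - U‖ * (2 * s) := by
    refine (frobenius_norm_mul _ _).trans ?_
    rw [frobenius_norm_transpose]
    gcongr
  have h6 : ‖(U + W) * (K * (Uᵀ * (W - U))) * (U + W)ᵀ‖ ≤
      2 * s * (s * (s * ‖W - U‖)) * (2 * s) := by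
    refine (frobenius_norm_mul _ _).trans ?_
    rw [frobenius_norm_transpose]
    gcongr
    refine (frobenius_norm_mul _ _).trans ?_
    gcongr
    refine (frobenius_norm_mul _ _).trans ?_
    gcongr
    refine (frobenius_norm_mul _ _).trans ?_
    rw [frobenius_norm_transpose, hnU]
  have h7 : 2 * ‖rotation U W - 1‖ = ‖(2 : ℝ) • (rotation U W - 1)‖ := by
    rw [norm_smul, Real.norm_eq_abs, abs_two]
  have h8 := norm_add_le ((2 : ℝ) • (U * (W - U)ᵀ) - (W - U) * (U + W)ᵀ)
    ((U + W) * (K * (Uᵀ * (W - U))) * (U + W)ᵀ)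
  have h9 := norm_sub_le ((2 : ℝ) • (U * (W - U)ᵀ)) ((W - U) * (U + W)ᵀ)
  rw [← h2, ← h7] at h8
  nlinarith

/-- A frame `W` of the column space of `U + ξ` that is in polar position to `U` is close to `U`. -/
theorem norm_sub_le_of_polar {ξ : Matrix m n ℝ} {G : Matrix n n ℝ} (hU : Uᵀ * U = 1)
    (hW : Wᵀ * W = 1) (hC : (Uᵀ * W).PosSemidef) (hξ : Uᵀ * ξ = 0) (hG : U + ξ = W * G) :
    ‖W - U‖ ≤ (√(Fintype.card n) ^ 2 + √(Fintype.card n) ^ 4 + √(Fintype.card n) ^ 6) * ‖ξ‖ := by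
  set s := √(Fintype.card n) with hs
  have hs0 : 0 ≤ s := Real.sqrt_nonneg _
  have hnU : ‖U‖ = s := norm_eq_sqrt_card hU
  have hnW : ‖W‖ = s := norm_eq_sqrt_card hW
  have hCt : (Uᵀ * W)ᵀ = Uᵀ * W := by
    rw [transpose_mul, transpose_transpose, transpose_mul_comm_of_posSemidef hC]
  have hnC : ‖Uᵀ * W‖ ≤ s * s := by
    refine (frobenius_norm_mul _ _).trans ?_
    rw [frobenius_norm_transpose, hnU, hnW]
  generalize hCd : Uᵀ * W = C at *
  have hCG : C * G = 1 := by rw [← hCd, Matrix.mul_assoc, ← hG, Matrix.mul_add, hU, hξ, add_zero]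
  have hWC : W = U * C + ξ * C := by
    rw [← Matrix.add_mul, hG, Matrix.mul_assoc, mul_eq_one_comm.1 hCG, Matrix.mul_one]
  have hξU : ξᵀ * U = 0 := by rw [← transpose_transpose U, ← transpose_mul, hξ, transpose_zero]
  -- `1 - C²` is the Gram matrix of `ξ C`, and one of its two factors `ξ C` is merely bounded
  have h1 : (1 - C) * (1 + C) = (ξ * C)ᵀ * (ξ * C) := by
    have h : 1 = C * C + (ξ * C)ᵀ * (ξ * C) := by
      have hW' := hW
      rw [hWC, transpose_add, Matrix.add_mul, Matrix.mul_add, Matrix.mul_add, transpose_mul,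
        transpose_mul, hCt] at hW'
      have e1 : C * Uᵀ * (U * C) = C * C := by
        rw [Matrix.mul_assoc, ← Matrix.mul_assoc Uᵀ, hU, Matrix.one_mul]
      have e2 : C * Uᵀ * (ξ * C) = 0 := by
        rw [Matrix.mul_assoc, ← Matrix.mul_assoc Uᵀ, hξ, Matrix.zero_mul, Matrix.mul_zero]
      have e3 : C * ξᵀ * (U * C) = 0 := by
        rw [Matrix.mul_assoc, ← Matrix.mul_assoc ξᵀ, hξU, Matrix.zero_mul, Matrix.mul_zero]
      rw [e1, e2, e3, add_zero, zero_add] at hW'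
      rw [transpose_mul, hCt, hW']
    rw [eq_sub_of_add_eq' h.symm]
    noncomm_ring
  have hξC : ‖ξ * C‖ ≤ s + s * (s * s) := by
    rw [eq_sub_of_add_eq' hWC.symm]
    refine (norm_sub_le _ _).trans ?_
    rw [hnW]
    gcongr
    refine (frobenius_norm_mul _ _).trans ?_
    rw [hnU]
    gcongr
  have hξC' : ‖ξ * C‖ ≤ ‖ξ‖ * (s * s) := (frobenius_norm_mul _ _).trans (by gcongr)
  have h2 : ‖1 - C‖ ≤ (s + s * (s * s)) * (‖ξ‖ * (s * s)) := by
    refine (norm_le_norm_mul_one_add hC _).trans ?_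
    rw [h1]
    refine (frobenius_norm_mul _ _).trans ?_
    rw [frobenius_norm_transpose]
    gcongr
  have h3 : W - U = ξ * C - U * (1 - C) := by
    rw [Matrix.mul_sub, Matrix.mul_one]
    nth_rewrite 1 [hWC]
    abel
  have h4 : ‖U * (1 - C)‖ ≤ s * ‖1 - C‖ := (frobenius_norm_mul _ _).trans (by rw [hnU])
  rw [h3]
  refine (norm_sub_le _ _).trans ?_
  nlinarith [norm_nonneg ξ]

end Rotation

/-! ### Unfoldings of a tensor -/

section Tensor

variable {d : ℕ} {n r : Fin d → ℕ} (X : Tensor n)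

theorem core_eq_unfolding (U : Factors n r) (i : Fin d) (k : (i : Fin d) → Fin (r i)) :
    core X U k = ((unfolding X U i)ᵀ * U i) (fun j => k j) (k i) := by
  simp only [core, unfolding, Matrix.mul_apply, transpose_apply, Finset.sum_mul, ite_mul, zero_mul]
  rw [Finset.sum_comm]
  refine Finset.sum_congr rfl fun p _ => ?_
  rw [Finset.sum_ite_eq, if_pos (Finset.mem_univ _), Fintype.prod_eq_mul_prod_subtype_ne _ i]
  ring

theorem unfolding_congr {U W : Factors n r} (i : Fin d) (h : ∀ j, j ≠ i → U j = W j) :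
    unfolding X U i = unfolding X W i := by
  ext a k
  simp only [unfolding]
  refine Finset.sum_congr rfl fun p _ => ?_
  congr 2
  exact Finset.prod_congr rfl fun j _ => by rw [h j j.2]

theorem precond_eq (U : Factors n r) (i : Fin d) :
    precond X U i = ((unfolding X U i)ᵀ * U i)ᵀ * ((unfolding X U i)ᵀ * U i) := by
  simp [precond, Matrix.mul_assoc]

theorem cost_eq_unfolding (U : Factors n r) (i : Fin d) :
    cost X U = -(1 / 2) * ‖(unfolding X U i)ᵀ * U i‖ ^ 2 := by
  rw [cost, frobenius_norm_sq_eq_sum, ← Fintype.sum_prod_type',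
    ← (Equiv.prodComm _ _).sum_comp, ← (Equiv.piSplitAt i fun j => Fin (r j)).sum_comp]
  simp only [core_eq_unfolding X U i]
  rfl

/-- The restricted Lipschitz-type inequality holds with constant `1`, on all regular points. With
`B = Yᵀ U` and `Z = Yᵀ V`, it amounts to `0 ≤ ‖Z - B Gᵀ‖²`, where `U + ν = V G`. -/
theorem isBlockLipschitz_one : IsBlockLipschitz X (regularPoints (r := r) X) fun _ => 1 := by
  intro U hU i ν V hν ⟨hV, G, hG⟩
  have hUi : (U i)ᵀ * U i = 1 := hU.1 i
  have hUν : (U i)ᵀ * ν = 0 := hν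
  have hνU : νᵀ * U i = 0 := by
    rw [← transpose_transpose (U i), ← transpose_mul, hUν, transpose_zero]
  have hG2 : Gᵀ * G = 1 + νᵀ * ν := by
    have h : (V * G)ᵀ * (V * G) = Gᵀ * G := by
      rw [transpose_mul, Matrix.mul_assoc, ← Matrix.mul_assoc Vᵀ, hV, Matrix.one_mul]
    rw [← h, ← hG, transpose_add, Matrix.add_mul, Matrix.mul_add, Matrix.mul_add, hUi, hUν, hνU,
      add_zero, zero_add]
  have hY : unfolding X (Function.update U i V) i = unfolding X U i :=
    unfolding_congr X i fun j hj => Function.update_of_ne hj _ _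
  rw [cost_eq_unfolding X _ i, cost_eq_unfolding X U i, hY, Function.update_self,
    blockInner_grad X hU i ν hν]
  simp only [blockInner, precond_eq]
  set Y := unfolding X U i
  set B := Yᵀ * U i with hB
  have h1 : ((-(Y * Yᵀ * U i))ᵀ * ν).trace = -(Bᵀ * (Yᵀ * ν)).trace := by
    rw [hB]
    simp [Matrix.mul_assoc]
  have h2 : (νᵀ * (ν * (Bᵀ * B))).trace = (B * (νᵀ * ν) * Bᵀ).trace := by
    rw [Matrix.mul_assoc B, trace_mul_comm B]
    simp only [Matrix.mul_assoc]
  have hE : Yᵀ * ν = Yᵀ * V * G - B := by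
    rw [Matrix.mul_assoc, ← hG, Matrix.mul_add, hB]
    abel
  have h3 : ‖Yᵀ * V - B * Gᵀ‖ ^ 2 =
      ‖Yᵀ * V‖ ^ 2 - 2 * (Bᵀ * (Yᵀ * V * G)).trace + (‖B‖ ^ 2 + (B * (νᵀ * ν) * Bᵀ).trace) := by
    have e1 : ((Yᵀ * V)ᵀ * (B * Gᵀ)).trace = (Bᵀ * (Yᵀ * V * G)).trace := by
      rw [← trace_transpose, transpose_mul, transpose_mul, transpose_transpose, transpose_transpose,
        Matrix.mul_assoc, trace_mul_comm, Matrix.mul_assoc]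
    have e2 : ((B * Gᵀ)ᵀ * (Yᵀ * V)).trace = (Bᵀ * (Yᵀ * V * G)).trace := by
      rw [← e1, ← trace_transpose, transpose_mul, transpose_transpose]
    have e3 : ((B * Gᵀ)ᵀ * (B * Gᵀ)).trace = ‖B‖ ^ 2 + (B * (νᵀ * ν) * Bᵀ).trace := by
      rw [trace_mul_comm, transpose_mul, transpose_transpose, Matrix.mul_assoc,
        ← Matrix.mul_assoc Gᵀ, hG2, Matrix.add_mul, Matrix.one_mul, Matrix.mul_add, trace_add,
        frobenius_norm_sq', Matrix.mul_assoc B]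
    rw [frobenius_norm_sq, transpose_sub, Matrix.sub_mul, Matrix.mul_sub, Matrix.mul_sub, trace_sub,
      trace_sub, trace_sub, e1, e2, e3, ← frobenius_norm_sq]
    ring
  have h4 : (Bᵀ * (Yᵀ * ν)).trace = (Bᵀ * (Yᵀ * V * G)).trace - ‖B‖ ^ 2 := by
    rw [hE, Matrix.mul_sub, trace_sub, frobenius_norm_sq]
  rw [h1, h2, h4]
  nlinarith [sq_nonneg ‖Yᵀ * V - B * Gᵀ‖]

/-- The matrices `Y₍ᵢ₎ Y₍ᵢ₎ᵀ` depend on the subspaces only, not on the orthonormal bases chosen. -/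
theorem unfolding_mul_transpose_eq {U W : Factors n r}
    (Q : (j : Fin d) → Matrix (Fin (r j)) (Fin (r j)) ℝ)
    (hQ : ∀ j, (Q j)ᵀ * Q j = 1) (hW : ∀ j, W j = U j * Q j) (i : Fin d) :
    unfolding X W i * (unfolding X W i)ᵀ = unfolding X U i * (unfolding X U i)ᵀ := by
  obtain ⟨K, hK⟩ : ∃ K : Matrix ((j : {j : Fin d // j ≠ i}) → Fin (r j))
      ((j : {j : Fin d // j ≠ i}) → Fin (r j)) ℝ,
      ∀ l k, K l k = ∏ j : {j : Fin d // j ≠ i}, Q j (l j) (k j) := ⟨fun l k => _, fun _ _ => rfl⟩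
  have h1 : unfolding X W i = unfolding X U i * K := by
    ext a k
    simp only [unfolding, Matrix.mul_apply, Finset.sum_mul, ite_mul, zero_mul, hK]
    rw [Finset.sum_comm]
    refine Finset.sum_congr rfl fun p _ => ?_
    split_ifs
    · simp_rw [hW, Matrix.mul_apply, Finset.prod_univ_sum, Fintype.piFinset_univ, Finset.mul_sum,
        Finset.prod_mul_distrib, mul_assoc]
    · simp
  have h2 : K * Kᵀ = 1 := by
    ext l l'
    simp only [Matrix.mul_apply, transpose_apply, hK]
    have h3 (j : {j : Fin d // j ≠ i}) :
        ∑ k, Q j (l j) k * Q j (l' j) k = if l j = l' j then 1 else 0 := by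
      have h := mul_eq_one_comm.1 (hQ j.1)
      have := congr_fun (congr_fun h (l j)) (l' j)
      rwa [Matrix.mul_apply, Matrix.one_apply] at this
    have h4 := Finset.prod_univ_sum (fun j : {j : Fin d // j ≠ i} => Finset.univ)
      (fun j k => Q j (l j) k * Q j (l' j) k)
    simp only [Fintype.piFinset_univ, Finset.prod_mul_distrib] at h4
    rw [← h4]
    simp only [h3, Matrix.one_apply, Finset.prod_ite_zero, Finset.prod_const_one]
    simp [funext_iff]
  rw [h1, transpose_mul, Matrix.mul_assoc, ← Matrix.mul_assoc K, h2, Matrix.one_mul]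

theorem abs_prod_le_one {ι : Type*} (s : Finset ι) {a : ι → ℝ} (ha : ∀ i, |a i| ≤ 1) :
    |∏ i ∈ s, a i| ≤ 1 := by
  rw [Finset.abs_prod]
  exact Finset.prod_le_one (fun _ _ => abs_nonneg _) fun i _ => ha i

theorem abs_prod_sub_prod_le {ι : Type*} (s : Finset ι) {a b : ι → ℝ} (ha : ∀ i, |a i| ≤ 1)
    (hb : ∀ i, |b i| ≤ 1) : |∏ i ∈ s, a i - ∏ i ∈ s, b i| ≤ ∑ i ∈ s, |a i - b i| := by
  classical
  induction s using Finset.induction_on with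
  | empty => simp
  | insert i s hi ih =>
    rw [Finset.prod_insert hi, Finset.prod_insert hi, Finset.sum_insert hi]
    have h : a i * ∏ j ∈ s, a j - b i * ∏ j ∈ s, b j =
        (a i - b i) * ∏ j ∈ s, a j + b i * (∏ j ∈ s, a j - ∏ j ∈ s, b j) := by ring
    rw [h]
    refine (abs_add_le _ _).trans ?_
    rw [abs_mul, abs_mul]
    exact add_le_add (mul_le_of_le_one_right (abs_nonneg _) (abs_prod_le_one s ha))
      ((mul_le_of_le_one_left (abs_nonneg _) (hb i)).trans ih)

theorem abs_apply_le_norm {m n : Type*} [Fintype m] [Fintype n] (A : Matrix m n ℝ) (a : m) (b : n) :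
    |A a b| ≤ ‖A‖ := by
  refine abs_le_of_sq_le_sq' ?_ (norm_nonneg _) |> abs_le.2
  rw [frobenius_norm_sq_eq_sum]
  exact (Finset.single_le_sum (f := fun j => A a j ^ 2) (fun _ _ => sq_nonneg _)
    (Finset.mem_univ b)).trans (Finset.single_le_sum (f := fun i => ∑ j, A i j ^ 2)
      (fun _ _ => by positivity) (Finset.mem_univ a))

theorem norm_unfolding_le {U : Factors n r} (hU : U ∈ orthonormalFactors n r) (i : Fin d) :
    ‖unfolding X U i‖ ≤ Fintype.card (Fin (n i) × ((j : {j : Fin d // j ≠ i}) → Fin (r j))) *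
      ∑ p, |X p| := by
  refine (frobenius_norm_le_sum _).trans ?_
  rw [← Fintype.sum_prod_type', ← nsmul_eq_mul]
  refine Finset.sum_le_card_nsmul _ _ _ fun x _ => ?_
  refine (Finset.abs_sum_le_sum_abs _ _).trans (Finset.sum_le_sum fun p _ => ?_)
  split_ifs
  · rw [abs_mul]
    exact mul_le_of_le_one_right (abs_nonneg _)
      (abs_prod_le_one _ fun j => abs_le_one_of_transpose_mul_self (hU j) _ _)
  · simp

theorem norm_unfolding_sub_le {U W : Factors n r} (hU : U ∈ orthonormalFactors n r)
    (hW : W ∈ orthonormalFactors n r) (i : Fin d) :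
    ‖unfolding X U i - unfolding X W i‖ ≤
      Fintype.card (Fin (n i) × ((j : {j : Fin d // j ≠ i}) → Fin (r j))) *
        ((∑ p, |X p|) * ∑ j, ‖U j - W j‖) := by
  refine (frobenius_norm_le_sum _).trans ?_
  rw [← Fintype.sum_prod_type', ← nsmul_eq_mul]
  refine Finset.sum_le_card_nsmul _ _ _ fun x _ => ?_
  simp only [Matrix.sub_apply, unfolding]
  rw [← Finset.sum_sub_distrib, Finset.sum_mul]
  refine (Finset.abs_sum_le_sum_abs _ _).trans (Finset.sum_le_sum fun p _ => ?_)
  split_ifs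
  · rw [← mul_sub, abs_mul]
    refine mul_le_mul_of_nonneg_left ?_ (abs_nonneg _)
    refine (abs_prod_sub_prod_le _
      (fun j : {j : Fin d // j ≠ i} => abs_le_one_of_transpose_mul_self (hU j) _ _)
      fun j => abs_le_one_of_transpose_mul_self (hW j) _ _).trans ?_
    rw [Fintype.sum_eq_add_sum_subtype_ne (fun j => ‖U j - W j‖) i]
    refine le_add_of_nonneg_of_le (norm_nonneg _) (Finset.sum_le_sum fun j _ => ?_)
    exact abs_apply_le_norm (U j - W j) _ _
  · rw [sub_zero, abs_zero]
    positivity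

/-- On orthonormal factors, `Y₍ᵢ₎ Y₍ᵢ₎ᵀ` is bounded and Lipschitz. -/
theorem exists_unfolding_mul_transpose_lipschitz (i : Fin d) :
    ∃ c : ℝ, ∀ U ∈ orthonormalFactors n r, ∀ W ∈ orthonormalFactors n r,
      ‖unfolding X U i * (unfolding X U i)ᵀ‖ ≤ c ∧
      ‖unfolding X U i * (unfolding X U i)ᵀ - unfolding X W i * (unfolding X W i)ᵀ‖ ≤
        c * ∑ j, ‖U j - W j‖ := by
  set N : ℝ := (Fintype.card (Fin (n i) × ((j : {j : Fin d // j ≠ i}) → Fin (r j))) : ℝ) with hN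
  set b := N * ∑ p, |X p| with hb
  have hb0 : 0 ≤ b := by positivity
  refine ⟨2 * b ^ 2, fun U hU W hW => ?_⟩
  have h1 := norm_unfolding_le X hU i
  have h2 := norm_unfolding_le X hW i
  have h3 := norm_unfolding_sub_le X hU hW i
  rw [← hN, ← hb] at h1 h2
  rw [← hN, ← mul_assoc, ← hb] at h3
  set δ := ∑ j, ‖U j - W j‖
  generalize unfolding X U i = Y at *
  generalize unfolding X W i = Z at *
  constructor
  · refine (frobenius_norm_mul _ _).trans ?_
    rw [frobenius_norm_transpose]
    nlinarith [norm_nonneg Y]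
  · have h4 : Y * Yᵀ - Z * Zᵀ = Y * (Y - Z)ᵀ + (Y - Z) * Zᵀ := by
      rw [transpose_sub, Matrix.mul_sub, Matrix.sub_mul]
      abel
    rw [h4]
    refine (norm_add_le _ _).trans ?_
    have h5 : ‖Y * (Y - Z)ᵀ‖ ≤ b * (b * δ) := by
      refine (frobenius_norm_mul _ _).trans ?_
      rw [frobenius_norm_transpose]
      gcongr
    have h6 : ‖(Y - Z) * Zᵀ‖ ≤ b * δ * b := by
      refine (frobenius_norm_mul _ _).trans ?_
      rw [frobenius_norm_transpose]
      gcongr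
    linarith

end Tensor

/-! ### The square root of the preconditioner -/

section Metric

variable {d : ℕ} {n r : Fin d → ℕ} (X : Tensor n)

/-- The square root of the preconditioner. It turns the preconditioned metric into the Frobenius
inner product. -/
noncomputable def sqrtPrecond (U : Factors n r) (i : Fin d) : Matrix (Fin (r i)) (Fin (r i)) ℝ :=
  CFC.sqrt (precond X U i)

variable {X}

theorem posDef_sqrtPrecond {U : Factors n r} (hU : U ∈ regularPoints X) (i : Fin d) :
    (sqrtPrecond X U i).PosDef :=
  posDef_sqrt (hU.2 i)

theorem isUnit_det_sqrtPrecond {U : Factors n r} (hU : U ∈ regularPoints X) (i : Fin d) :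
    IsUnit (sqrtPrecond X U i).det :=
  (isUnit_iff_isUnit_det _).1 (posDef_sqrtPrecond hU i).isUnit

theorem transpose_sqrtPrecond (U : Factors n r) (i : Fin d) :
    (sqrtPrecond X U i)ᵀ = sqrtPrecond X U i :=
  transpose_sqrt _

theorem sqrtPrecond_mul_self {U : Factors n r} (hU : U ∈ regularPoints X) (i : Fin d) :
    sqrtPrecond X U i * sqrtPrecond X U i = precond X U i :=
  sqrt_mul_self (hU.2 i).posSemidef

theorem blockInner_self_eq {U : Factors n r} (hU : U ∈ regularPoints X) (i : Fin d)
    (ξ : Matrix (Fin (n i)) (Fin (r i)) ℝ) :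
    blockInner X U i ξ ξ = ‖ξ * sqrtPrecond X U i‖ ^ 2 := by
  rw [blockInner, ← sqrtPrecond_mul_self hU, frobenius_norm_sq, transpose_mul,
    transpose_sqrtPrecond, Matrix.mul_assoc, trace_mul_comm (sqrtPrecond X U i)]
  simp only [Matrix.mul_assoc]

theorem exists_norm_inv_sqrtPrecond_le {D : Set (Factors n r)} (hD : D ⊆ regularPoints X)
    (hc : IsCompact D) : ∃ c : ℝ, 0 ≤ c ∧ ∀ U ∈ D, ∀ i, ‖(sqrtPrecond X U i)⁻¹‖ ≤ c := by
  obtain ⟨b, hb0, hb⟩ := exists_trace_inv_precond_le X hD hc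
  refine ⟨√b, Real.sqrt_nonneg _, fun U hU i => Real.le_sqrt_of_sq_le ?_⟩
  rw [frobenius_norm_sq, transpose_nonsing_inv, transpose_sqrtPrecond, ← Matrix.mul_inv_rev,
    sqrtPrecond_mul_self (hD hU)]
  exact hb U hU i

theorem norm_le_mul_sqrt_blockInner {U : Factors n r} (hU : U ∈ regularPoints X) (i : Fin d)
    {c : ℝ} (hc : ‖(sqrtPrecond X U i)⁻¹‖ ≤ c) (ξ : Matrix (Fin (n i)) (Fin (r i)) ℝ) :
    ‖ξ‖ ≤ c * √(blockInner X U i ξ ξ) := by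
  rw [blockInner_self_eq hU, Real.sqrt_sq (norm_nonneg _)]
  have h := frobenius_norm_mul (ξ * sqrtPrecond X U i) (sqrtPrecond X U i)⁻¹
  rw [mul_nonsing_inv_cancel_right _ _ (isUnit_det_sqrtPrecond hU i)] at h
  nlinarith [norm_nonneg (ξ * sqrtPrecond X U i)]

/-- The gradient in coordinates in which the metric is the Frobenius inner product. -/
theorem grad_mul_sqrtPrecond {U : Factors n r} (hU : U ∈ regularPoints X) (i : Fin d) :
    grad X U i * sqrtPrecond X U i = U i * sqrtPrecond X U i -
      unfolding X U i * (unfolding X U i)ᵀ * U i * (sqrtPrecond X U i)⁻¹ := by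
  rw [grad, Matrix.sub_mul, ← sqrtPrecond_mul_self hU, Matrix.mul_inv_rev,
    Matrix.mul_assoc _ (_ * _) (sqrtPrecond X U i),
    nonsing_inv_mul_cancel_right _ _ (isUnit_det_sqrtPrecond hU i)]

end Metric

/-! ### The vector transport -/

section Transport

variable {d : ℕ} {n r : Fin d → ℕ} {X : Tensor n}

/-- An orthogonal matrix `Q` that puts the frame `V * Q` in polar position to `U`. -/
noncomputable def align {m n : Type*} [Fintype m] [Fintype n] [DecidableEq n]
    (U V : Matrix m n ℝ) : Matrix n n ℝ :=
  (exists_polar (Uᵀ * V)).choose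

theorem align_orthogonal {m n : Type*} [Fintype m] [Fintype n] [DecidableEq n]
    (U V : Matrix m n ℝ) : (align U V)ᵀ * align U V = 1 :=
  (exists_polar (Uᵀ * V)).choose_spec.1

theorem posSemidef_align {m n : Type*} [Fintype m] [Fintype n] [DecidableEq n]
    (U V : Matrix m n ℝ) : (Uᵀ * (V * align U V)).PosSemidef := by
  rw [← Matrix.mul_assoc]
  exact (exists_polar (Uᵀ * V)).choose_spec.2

theorem align_self {m n : Type*} [Fintype m] [Fintype n] [DecidableEq n]
    {U : Matrix m n ℝ} (hU : Uᵀ * U = 1) : align U U = 1 := by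
  have h1 := align_orthogonal U U
  have h2 := posSemidef_align U U
  rw [← Matrix.mul_assoc, hU, Matrix.one_mul] at h2
  have h3 : (align U U)ᵀ = align U U := by
    simpa [conjTranspose_eq_transpose_of_trivial] using h2.isHermitian.eq
  rw [h3] at h1
  -- `Q² = 1` makes `(Q - 1) (1 + Q)` vanish
  have h4 := norm_le_norm_mul_one_add h2 (align U U - 1)
  rw [Matrix.mul_add, Matrix.mul_one, Matrix.sub_mul, h1, Matrix.one_mul, sub_add_sub_cancel,
    sub_self, norm_zero] at h4
  exact sub_eq_zero.1 (norm_le_zero_iff.1 h4)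

theorem transpose_mul_self_mul_align {m n : Type*} [Fintype m] [Fintype n] [DecidableEq n]
    (U : Matrix m n ℝ) {V : Matrix m n ℝ} (hV : Vᵀ * V = 1) :
    (V * align U V)ᵀ * (V * align U V) = 1 := by
  rw [transpose_mul, Matrix.mul_assoc, ← Matrix.mul_assoc Vᵀ, hV, Matrix.one_mul,
    align_orthogonal]

/-- The vector transport. On the left, a tangent vector is moved by the direct rotation of the
column space of `U i` to that of `V i`; the factor on the right passes from the basis `U i` to
the basis `V i` and from the metric at `U` to the metric at `V`. -/
noncomputable def transport (X : Tensor n) (U V : Factors n r) (i : Fin d) :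
    Matrix (Fin (n i)) (Fin (r i)) ℝ →ₗ[ℝ] Matrix (Fin (n i)) (Fin (r i)) ℝ where
  toFun η := rotation (V i) (U i * align (V i) (U i)) * η *
    (sqrtPrecond X U i * align (V i) (U i) * (sqrtPrecond X V i)⁻¹)
  map_add' η ζ := by rw [Matrix.mul_add, Matrix.add_mul]
  map_smul' a η := by rw [Matrix.mul_smul, Matrix.smul_mul, RingHom.id_apply]

theorem transport_apply (U V : Factors n r) (i : Fin d) (η : Matrix (Fin (n i)) (Fin (r i)) ℝ) :
    transport X U V i η = rotation (V i) (U i * align (V i) (U i)) * η *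
      (sqrtPrecond X U i * align (V i) (U i) * (sqrtPrecond X V i)⁻¹) :=
  rfl

theorem transport_mul_sqrtPrecond (U : Factors n r) {V : Factors n r} (hV : V ∈ regularPoints X)
    (i : Fin d) (η : Matrix (Fin (n i)) (Fin (r i)) ℝ) :
    transport X U V i η * sqrtPrecond X V i =
      rotation (V i) (U i * align (V i) (U i)) * (η * sqrtPrecond X U i * align (V i) (U i)) := by
  rw [transport_apply, Matrix.mul_assoc _ (_ * _ * _),
    nonsing_inv_mul_cancel_right _ _ (isUnit_det_sqrtPrecond hV i)]
  simp only [Matrix.mul_assoc]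

theorem isIsometricTransport_transport {D : Set (Factors n r)} (hD : D ⊆ regularPoints X) :
    IsIsometricTransport X D (transport X) where
  horizontal U hU V hV i η hη := by
    have h1 := transpose_rotation_mul ((hD hV).1 i) (posSemidef_align (V i) (U i))
    have h2 : (V i)ᵀ * rotation (V i) (U i * align (V i) (U i)) = (U i * align (V i) (U i))ᵀ := by
      conv_rhs => rw [← h1, transpose_mul, transpose_transpose]
    have h3 : (U i)ᵀ * η = 0 := hη
    rw [IsHorizontal, transport_apply, ← Matrix.mul_assoc (V i)ᵀ, ← Matrix.mul_assoc (V i)ᵀ, h2,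
      transpose_mul, Matrix.mul_assoc _ _ η, h3,
      Matrix.mul_zero, Matrix.zero_mul]
  isometry U hU V hV i η _ := by
    rw [blockInner_self_eq (hD hV), blockInner_self_eq (hD hU), transport_mul_sqrtPrecond U (hD hV),
      norm_mul_of_transpose_mul_self (transpose_rotation_mul_rotation ((hD hV).1 i)
        (transpose_mul_self_mul_align _ ((hD hU).1 i)) (posSemidef_align _ _)),
      norm_mul_of_mul_transpose_self (mul_eq_one_comm.1 (align_orthogonal _ _))]
  self U hU i η _ := by
    have hUi : (U i)ᵀ * U i = 1 := (hD hU).1 i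
    have h1 : rotation (U i) (U i) = 1 := by
      have h := norm_rotation_sub_one_le hUi hUi (by rw [hUi]; exact PosSemidef.one)
      rw [sub_self (U i), norm_zero, mul_zero] at h
      exact sub_eq_zero.1 (norm_le_zero_iff.1 h)
    rw [transport_apply, align_self hUi, Matrix.mul_one, Matrix.mul_one, h1, Matrix.one_mul,
      mul_nonsing_inv _ (isUnit_det_sqrtPrecond (hD hU) i), Matrix.mul_one]

theorem norm_mul_le_mul {l m n : Type*} [Fintype l] [Fintype m] [Fintype n] {P : Matrix l m ℝ}
    {R : Matrix m n ℝ} {p q : ℝ} (hp : ‖P‖ ≤ p) (hq : ‖R‖ ≤ q) : ‖P * R‖ ≤ p * q :=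
  (frobenius_norm_mul P R).trans (mul_le_mul hp hq (norm_nonneg _) ((norm_nonneg _).trans hp))

/-- The perturbation estimate for the gradient, in the form `U M - A U M⁻¹` with `M² = Uᵀ A U` that
`grad_mul_sqrtPrecond` gives it. -/
theorem exists_norm_gradient_sub_le (m n : Type*) [Fintype m] [Fintype n] [DecidableEq m]
    [DecidableEq n] {α c : ℝ} (hα : 0 ≤ α) (hc : 0 ≤ c) :
    ∃ K : ℝ, 0 ≤ K ∧ ∀ (U W : Matrix m n ℝ) (A B O : Matrix m m ℝ) (M N : Matrix n n ℝ) (ε : ℝ),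
      Uᵀ * U = 1 → Wᵀ * W = 1 → M.PosDef → N.PosDef → M * M = Uᵀ * A * U → N * N = Wᵀ * B * W →
      ‖A‖ ≤ α → ‖B‖ ≤ α → ‖M⁻¹‖ ≤ c → ‖N⁻¹‖ ≤ c → ‖A - B‖ ≤ ε → ‖U - W‖ ≤ ε → ‖O - 1‖ ≤ ε →
      ‖U * M - A * U * M⁻¹ - O * (W * N - B * W * N⁻¹)‖ ≤ K * ε := by
  set s := √(Fintype.card n : ℝ) with hs
  have hs0 : 0 ≤ s := Real.sqrt_nonneg _
  set k := α * s + s * s + s * α with hk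
  have hk0 : 0 ≤ k := by positivity
  set b := c * (s * α * s) with hb
  have hb0 : 0 ≤ b := by positivity
  refine ⟨b + s * (c * k) + (s * c + α * c + α * s * (c * (c * k) * c)) + (s * b + α * s * c),
    by positivity, ?_⟩
  intro U W A B O M N ε hU hW hM hN hMM hNN hA hB hMc hNc hAB hUW hO
  have hε : 0 ≤ ε := (norm_nonneg _).trans hUW
  have hnU : ‖U‖ ≤ s := (norm_eq_sqrt_card hU).le
  have hnW : ‖W‖ ≤ s := (norm_eq_sqrt_card hW).le
  have hnUt : ‖Uᵀ‖ ≤ s := by rwa [frobenius_norm_transpose]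
  have hnWt : ‖Wᵀ‖ ≤ s := by rwa [frobenius_norm_transpose]
  have hMu : IsUnit M.det := (isUnit_iff_isUnit_det _).1 hM.isUnit
  have hNu : IsUnit N.det := (isUnit_iff_isUnit_det _).1 hN.isUnit
  have hMb : ‖M‖ ≤ b := by
    rw [← nonsing_inv_mul_cancel_left M M hMu, hMM]
    exact norm_mul_le_mul hMc (norm_mul_le_mul (norm_mul_le_mul hnUt hA) hnU)
  have hNb : ‖N‖ ≤ b := by
    rw [← nonsing_inv_mul_cancel_left N N hNu, hNN]
    exact norm_mul_le_mul hNc (norm_mul_le_mul (norm_mul_le_mul hnWt hB) hnW)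
  have hMN : ‖M - N‖ ≤ c * (k * ε) := by
    refine (norm_sub_le_mul_norm_mul_self_sub hM hN.posSemidef hMc).trans
      (mul_le_mul_of_nonneg_left ?_ hc)
    have h : M * M - N * N =
        (U - W)ᵀ * (A * U) + Wᵀ * ((A - B) * U) + Wᵀ * (B * (U - W)) := by
      rw [hMM, hNN]
      simp only [transpose_sub, Matrix.mul_sub, Matrix.sub_mul, Matrix.mul_assoc]
      abel
    have h1 : ‖(U - W)ᵀ * (A * U)‖ ≤ ε * (α * s) :=
      norm_mul_le_mul (by rwa [frobenius_norm_transpose]) (norm_mul_le_mul hA hnU)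
    have h2 : ‖Wᵀ * ((A - B) * U)‖ ≤ s * (ε * s) := norm_mul_le_mul hnWt (norm_mul_le_mul hAB hnU)
    have h3 : ‖Wᵀ * (B * (U - W))‖ ≤ s * (α * ε) := norm_mul_le_mul hnWt (norm_mul_le_mul hB hUW)
    rw [h]
    refine norm_add₃_le.trans ?_
    rw [hk]
    linarith
  have hMN' : ‖M⁻¹ - N⁻¹‖ ≤ c * (c * (k * ε)) * c := by
    have h : M⁻¹ - N⁻¹ = M⁻¹ * (N - M) * N⁻¹ := by
      rw [Matrix.mul_sub, Matrix.sub_mul, nonsing_inv_mul _ hMu, Matrix.one_mul,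
        mul_nonsing_inv_cancel_right _ _ hNu]
    rw [h]
    exact norm_mul_le_mul (norm_mul_le_mul hMc (by rwa [norm_sub_rev])) hNc
  have h1 : ‖(U - W) * M‖ ≤ ε * b := norm_mul_le_mul hUW hMb
  have h2 : ‖W * (M - N)‖ ≤ s * (c * (k * ε)) := norm_mul_le_mul hnW hMN
  have h3 : ‖(A - B) * (U * M⁻¹)‖ ≤ ε * (s * c) := norm_mul_le_mul hAB (norm_mul_le_mul hnU hMc)
  have h4 : ‖B * ((U - W) * M⁻¹)‖ ≤ α * (ε * c) := norm_mul_le_mul hB (norm_mul_le_mul hUW hMc)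
  have h5 : ‖B * (W * (M⁻¹ - N⁻¹))‖ ≤ α * (s * (c * (c * (k * ε)) * c)) :=
    norm_mul_le_mul hB (norm_mul_le_mul hnW hMN')
  have h6 : ‖W * N - B * W * N⁻¹‖ ≤ s * b + α * s * c :=
    (norm_sub_le _ _).trans (add_le_add (norm_mul_le_mul hnW hNb)
      (norm_mul_le_mul (norm_mul_le_mul hB hnW) hNc))
  have h7 : ‖(O - 1) * (W * N - B * W * N⁻¹)‖ ≤ ε * (s * b + α * s * c) := norm_mul_le_mul hO h6
  have h8 : U * M - A * U * M⁻¹ - O * (W * N - B * W * N⁻¹) =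
      ((U - W) * M + W * (M - N) -
        ((A - B) * (U * M⁻¹) + B * ((U - W) * M⁻¹) + B * (W * (M⁻¹ - N⁻¹)))) -
      (O - 1) * (W * N - B * W * N⁻¹) := by
    rw [Matrix.sub_mul O, Matrix.one_mul]
    simp only [Matrix.mul_sub, Matrix.sub_mul, Matrix.mul_assoc]
    abel
  rw [h8]
  have h9 := norm_sub_le ((U - W) * M + W * (M - N) -
        ((A - B) * (U * M⁻¹) + B * ((U - W) * M⁻¹) + B * (W * (M⁻¹ - N⁻¹))))
      ((O - 1) * (W * N - B * W * N⁻¹))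
  have h10 := norm_sub_le ((U - W) * M + W * (M - N))
        ((A - B) * (U * M⁻¹) + B * ((U - W) * M⁻¹) + B * (W * (M⁻¹ - N⁻¹)))
  have h11 := norm_add_le ((U - W) * M) (W * (M - N))
  have h12 : ‖(A - B) * (U * M⁻¹) + B * ((U - W) * M⁻¹) + B * (W * (M⁻¹ - N⁻¹))‖ ≤ _ :=
    norm_add₃_le
  linarith

theorem sqrt_sum_sq_le_sum {ι : Type*} [Fintype ι] {a : ι → ℝ} (ha : ∀ i, 0 ≤ a i) :
    √(∑ i, a i ^ 2) ≤ ∑ i, a i :=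
  Real.sqrt_le_iff.2 ⟨Finset.sum_nonneg fun i _ => ha i,
    Finset.sum_sq_le_sq_sum_of_nonneg fun i _ => ha i⟩

theorem exists_isRetractionLipschitz_transport {D : Set (Factors n r)} (hD : D ⊆ regularPoints X)
    (hcomp : IsCompact D) : ∃ K : ℝ, 0 < K ∧ IsRetractionLipschitz X D (transport X) K := by
  obtain ⟨c, hc0, hc⟩ := exists_norm_inv_sqrtPrecond_le hD hcomp
  choose α hα using exists_unfolding_mul_transpose_lipschitz (r := r) X
  choose K hK0 hK using fun i => exists_norm_gradient_sub_le (Fin (n i)) (Fin (r i))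
    (abs_nonneg (α i)) hc0
  let s : Fin d → ℝ := fun i => √(Fintype.card (Fin (r i)))
  let a : Fin d → ℝ := fun i => s i ^ 2 + s i ^ 4 + s i ^ 6
  let b : Fin d → ℝ := fun i => 2 * s i + 2 * s i ^ 4
  let e : Fin d → ℝ := fun i => |α i| + 1 + b i
  have hs0 i : 0 ≤ s i := Real.sqrt_nonneg _
  have ha0 i : 0 ≤ a i := by have := hs0 i; positivity
  have hb0 i : 0 ≤ b i := by have := hs0 i; positivity
  have he0 i : 0 ≤ e i := by have := hb0 i; positivity
  have hKe : 0 ≤ ∑ i, K i * e i := Finset.sum_nonneg fun i _ => mul_nonneg (hK0 i) (he0 i)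
  have ha0' : 0 ≤ ∑ j, a j * c := Finset.sum_nonneg fun i _ => mul_nonneg (ha0 i) hc0
  refine ⟨(∑ i, K i * e i) * (∑ j, a j * c) + 1, by positivity, ?_⟩
  intro U hU V hV hmix ξ hξ hret
  set Δ := displacementNorm X U V ξ with hΔ
  have hΔ0 : 0 ≤ Δ := Real.sqrt_nonneg _
  have hUr := hD hU
  have hVr := hD hV
  -- the representative of `V` whose factors are in polar position to those of `U`
  let W : Factors n r := fun j => V j * align (U j) (V j)
  have hW : W ∈ orthonormalFactors n r := fun j => transpose_mul_self_mul_align _ (hVr.1 j)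
  have hξΔ j : ‖ξ j‖ ≤ c * Δ := by
    refine (norm_le_mul_sqrt_blockInner (hD (hmix j)) j (hc _ (hmix j) j) _).trans ?_
    refine mul_le_mul_of_nonneg_left (Real.sqrt_le_sqrt ?_) hc0
    refine Finset.single_le_sum (f := fun j => blockInner X (mix U V j) j (ξ j) (ξ j))
      (fun i _ => ?_) (Finset.mem_univ j)
    rw [blockInner_self_eq (hD (hmix i))]
    positivity
  have hWU j : ‖U j - W j‖ ≤ a j * c * Δ := by
    obtain ⟨G, hG⟩ := (hret j).2
    have h := norm_sub_le_of_polar (G := (align (U j) (V j))ᵀ * G) (hUr.1 j) (hW j)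
      (posSemidef_align _ _) (hξ j) (by
        rw [hG, Matrix.mul_assoc, ← Matrix.mul_assoc (align (U j) (V j)),
          mul_eq_one_comm.1 (align_orthogonal (U j) (V j)), Matrix.one_mul])
    rw [norm_sub_rev, mul_assoc]
    exact h.trans (mul_le_mul_of_nonneg_left (hξΔ j) (ha0 j))
  set σ := ∑ j, ‖U j - W j‖ with hσ
  have hσ0 : 0 ≤ σ := by positivity
  have hσΔ : σ ≤ (∑ j, a j * c) * Δ := by
    rw [Finset.sum_mul]
    exact Finset.sum_le_sum fun j _ => hWU j
  have hWσ j : ‖U j - W j‖ ≤ σ :=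
    Finset.single_le_sum (f := fun j => ‖U j - W j‖) (fun _ _ => norm_nonneg _) (Finset.mem_univ j)
  have hblock i : √(blockInner X U i (grad X U i - transport X V U i (grad X V i))
      (grad X U i - transport X V U i (grad X V i))) ≤ K i * (e i * σ) := by
    rw [blockInner_self_eq hUr, Real.sqrt_sq (norm_nonneg _), Matrix.sub_mul,
      transport_mul_sqrtPrecond V hUr, grad_mul_sqrtPrecond hUr, grad_mul_sqrtPrecond hVr]
    -- in the frame `W i`, the square root of the preconditioner at `V` is `Qᵀ M Q`
    set Q := align (U i) (V i) with hQ
    have hQQ : Qᵀ * Q = 1 := align_orthogonal _ _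
    have hQQ' : Q * Qᵀ = 1 := mul_eq_one_comm.1 hQQ
    have hMV := posDef_sqrtPrecond hVr i
    have hMVu := isUnit_det_sqrtPrecond hVr i
    set M := sqrtPrecond X V i with hM
    have hN : (Qᵀ * M * Q)⁻¹ = Qᵀ * M⁻¹ * Q := by
      refine inv_eq_left_inv ?_
      rw [← Matrix.mul_assoc, ← Matrix.mul_assoc, Matrix.mul_assoc _ Q, hQQ', Matrix.mul_one,
        nonsing_inv_mul_cancel_right _ _ hMVu, hQQ]
    have hNpos : (Qᵀ * M * Q).PosDef := by
      have hinj : Function.Injective Q.mulVec :=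
        mulVec_injective_iff_isUnit.2 (IsUnit.of_mul_eq_one _ hQQ')
      simpa [conjTranspose_eq_transpose_of_trivial] using hMV.conjTranspose_mul_mul_same hinj
    have hNn : ‖(Qᵀ * M * Q)⁻¹‖ ≤ c := by
      rw [hN, norm_mul_of_mul_transpose_self hQQ', norm_mul_of_transpose_mul_self
        (by rwa [transpose_transpose])]
      exact hc V hV i
    have hAW : unfolding X W i * (unfolding X W i)ᵀ = unfolding X V i * (unfolding X V i)ᵀ :=
      unfolding_mul_transpose_eq X (fun j => align (U j) (V j)) (fun j => align_orthogonal _ _)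
        (fun _ => rfl) i
    have hNN : Qᵀ * M * Q * (Qᵀ * M * Q) =
        (W i)ᵀ * (unfolding X W i * (unfolding X W i)ᵀ) * W i := by
      have h : Qᵀ * M * Q * (Qᵀ * M * Q) = Qᵀ * (M * M) * Q := by
        rw [← Matrix.mul_assoc, ← Matrix.mul_assoc, Matrix.mul_assoc _ Q, hQQ', Matrix.mul_one]
        simp only [Matrix.mul_assoc]
      rw [h, hM, sqrtPrecond_mul_self hVr, hAW, precond]
      simp only [W, transpose_mul, Matrix.mul_assoc, ← hQ]
    have hMM := (sqrtPrecond_mul_self hUr i).trans rfl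
    have hrw : (V i * M - unfolding X V i * (unfolding X V i)ᵀ * V i * M⁻¹) * Q =
        W i * (Qᵀ * M * Q) - unfolding X W i * (unfolding X W i)ᵀ * W i * (Qᵀ * M * Q)⁻¹ := by
      have h (P : Matrix (Fin (r i)) (Fin (r i)) ℝ) : Q * (Qᵀ * P) = P := by
        rw [← Matrix.mul_assoc, hQQ', Matrix.one_mul]
      rw [hN, hAW]
      simp only [W, ← hQ, Matrix.sub_mul, Matrix.mul_assoc, h]
    rw [hrw]
    have hbi := hb0 i
    have hσe : e i * σ = |α i| * σ + σ + b i * σ := by simp only [e]; ring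
    refine hK i (U i) (W i) _ _ _ _ _ (e i * σ) (hUr.1 i) (hW i) (posDef_sqrtPrecond hUr i) hNpos
      hMM hNN ((hα i U hUr.1 W hW).1.trans (le_abs_self _))
      ((hα i W hW U hUr.1).1.trans (le_abs_self _)) (hc U hU i) hNn ?_ ?_ ?_
    · refine (hα i U hUr.1 W hW).2.trans ?_
      have := mul_le_mul_of_nonneg_right (le_abs_self (α i)) hσ0
      nlinarith
    · have := hWσ i
      nlinarith [mul_nonneg (abs_nonneg (α i)) hσ0]
    · refine (norm_rotation_sub_one_le (hUr.1 i) (hW i) (posSemidef_align _ _)).trans ?_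
      rw [norm_sub_rev]
      have := mul_le_mul_of_nonneg_left (hWσ i) hbi
      change b i * _ ≤ _
      nlinarith [mul_nonneg (abs_nonneg (α i)) hσ0]
  have hnn i : 0 ≤ blockInner X U i (grad X U i - transport X V U i (grad X V i))
      (grad X U i - transport X V U i (grad X V i)) := by
    rw [blockInner_self_eq hUr]
    positivity
  calc tangentNorm X U (fun i => grad X U i - transport X V U i (grad X V i))
      ≤ ∑ i, √(blockInner X U i (grad X U i - transport X V U i (grad X V i))
          (grad X U i - transport X V U i (grad X V i))) := by
        refine le_trans (le_of_eq ?_) (sqrt_sum_sq_le_sum fun i => Real.sqrt_nonneg _)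
        rw [tangentNorm]
        congr 1
        exact Finset.sum_congr rfl fun i _ => (Real.sq_sqrt (hnn i)).symm
    _ ≤ ∑ i, K i * (e i * σ) := Finset.sum_le_sum fun i _ => hblock i
    _ = (∑ i, K i * e i) * σ := by rw [Finset.sum_mul]; simp only [mul_assoc]
    _ ≤ (∑ i, K i * e i) * ((∑ j, a j * c) * Δ) := mul_le_mul_of_nonneg_left hσΔ hKe
    _ ≤ ((∑ i, K i * e i) * (∑ j, a j * c) + 1) * Δ := by nlinarith

end Transport

/-! ### Convergence of the coordinate descent -/

section Descent

variable {d : ℕ} {n r : Fin d → ℕ} {X : Tensor n}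

theorem blockInner_self_nonneg {U : Factors n r} (hU : U ∈ regularPoints X) (i : Fin d)
    (ξ : Matrix (Fin (n i)) (Fin (r i)) ℝ) : 0 ≤ blockInner X U i ξ ξ := by
  rw [blockInner_self_eq hU]
  positivity

theorem blockInner_self_le_two_mul_add {U : Factors n r} (hU : U ∈ regularPoints X) (i : Fin d)
    (ξ η : Matrix (Fin (n i)) (Fin (r i)) ℝ) : blockInner X U i ξ ξ ≤
      2 * blockInner X U i η η + 2 * blockInner X U i (ξ - η) (ξ - η) := by
  simp only [blockInner_self_eq hU, Matrix.sub_mul]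
  generalize ξ * sqrtPrecond X U i = A
  generalize η * sqrtPrecond X U i = B
  have h : ‖A‖ ≤ ‖B‖ + ‖A - B‖ := by
    simpa using norm_add_le B (A - B)
  nlinarith [sq_nonneg (‖B‖ - ‖A - B‖), norm_nonneg A]

theorem blockInner_neg_smul (U : Factors n r) (i : Fin d) (a : ℝ)
    (ξ η : Matrix (Fin (n i)) (Fin (r i)) ℝ) :
    blockInner X U i ξ (-(a • η)) = -a * blockInner X U i ξ η := by
  simp [blockInner]

theorem blockInner_neg_smul_neg_smul (U : Factors n r) (i : Fin d) (a : ℝ)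
    (ξ : Matrix (Fin (n i)) (Fin (r i)) ℝ) :
    blockInner X U i (-(a • ξ)) (-(a • ξ)) = a ^ 2 * blockInner X U i ξ ξ := by
  simp [blockInner]
  ring

theorem tangentNorm_sq {U : Factors n r} (hU : U ∈ regularPoints X) (ξ : Factors n r) :
    tangentNorm X U ξ ^ 2 = ∑ i, blockInner X U i (ξ i) (ξ i) :=
  Real.sq_sqrt (Finset.sum_nonneg fun i _ => blockInner_self_nonneg hU i _)

theorem isHorizontal_neg_smul {n r : ℕ} {U ξ : Matrix (Fin n) (Fin r) ℝ} (h : IsHorizontal U ξ)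
    (a : ℝ) : IsHorizontal U (-(a • ξ)) := by
  unfold IsHorizontal at *
  rw [Matrix.mul_neg, Matrix.mul_smul, h, smul_zero, neg_zero]

variable (X) in
theorem exists_le_cost : ∃ b : ℝ, ∀ U ∈ orthonormalFactors n r, b ≤ cost X U := by
  refine ⟨-(1 / 2) * ∑ _k : (i : Fin d) → Fin (r i), (∑ p, |X p|) ^ 2, fun U hU => ?_⟩
  refine mul_le_mul_of_nonpos_left (Finset.sum_le_sum fun k _ => ?_) (by norm_num)
  rw [← sq_abs]
  refine pow_le_pow_left₀ (abs_nonneg _) ?_ 2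
  refine (Finset.abs_sum_le_sum_abs _ _).trans (Finset.sum_le_sum fun p _ => ?_)
  rw [abs_mul]
  exact mul_le_of_le_one_right (abs_nonneg _)
    (abs_prod_le_one _ fun j => abs_le_one_of_transpose_mul_self (hU j) _ _)

namespace IsRPCD

variable {α : Fin d → ℝ} {y : ℕ → Fin (d + 1) → Factors n r}

/-- Each factor is changed once in an outer iteration, at its own inner iteration. -/
theorem apply_eq (hy : IsRPCD X α y) (t : ℕ) (k : Fin (d + 1)) (j : Fin d) :
    y t k j = if j.castSucc < k then y t j.succ j else y t 0 j := by
  induction k using Fin.induction with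
  | zero => simp
  | succ k ih =>
    rcases eq_or_ne j k with rfl | hjk
    · rw [if_pos j.castSucc_lt_succ]
    · rw [hy.fixed t k j hjk, ih]
      have : j.castSucc < k.castSucc ↔ j.castSucc < k.succ := by
        rw [Fin.lt_def, Fin.lt_def, Fin.val_castSucc, Fin.val_castSucc, Fin.val_succ]
        have := Fin.val_ne_of_ne hjk
        omega
      simp only [this]

theorem castSucc_apply_self (hy : IsRPCD X α y) (t : ℕ) (j : Fin d) :
    y t j.castSucc j = y t 0 j := by
  rw [hy.apply_eq, if_neg (lt_irrefl _)]

theorem mix_eq (hy : IsRPCD X α y) (t : ℕ) (k : Fin (d + 1)) (j : Fin d) :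
    mix (y t 0) (y t k) j = y t (min k j.castSucc) := by
  funext i
  rw [mix, hy.apply_eq t (min k j.castSucc), hy.apply_eq t k]
  simp only [lt_min_iff, Fin.castSucc_lt_castSucc_iff]
  split_ifs <;> tauto

/-- One inner iteration decreases the cost by at least `‖∇ₖf‖² / (2 Lₖ)`. -/
theorem blockInner_grad_le {D : Set (Factors n r)} {L : Fin d → ℝ} (hL0 : ∀ i, 0 < L i)
    (hD : D ⊆ regularPoints X) (hL : IsBlockLipschitz X D L)
    (hy : IsRPCD X (fun i => 1 / L i) y) (hyD : ∀ t k, y t k ∈ D) (t : ℕ) (k : Fin d) :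
    blockInner X (y t k.castSucc) k (grad X (y t k.castSucc) k) (grad X (y t k.castSucc) k) ≤
      2 * L k * (cost X (y t k.castSucc) - cost X (y t k.succ)) := by
  have h1 : y t k.succ = Function.update (y t k.castSucc) k (y t k.succ k) := by
    funext j
    rcases eq_or_ne j k with rfl | hjk
    · rw [Function.update_self]
    · rw [Function.update_of_ne hjk, hy.fixed t k j hjk]
  have h2 := hL _ (hyD t k.castSucc) k _ _
    (isHorizontal_neg_smul (isHorizontal_grad X (hD (hyD t k.castSucc)) k) (1 / L k)) (hy.step t k)
  rw [← h1, blockInner_neg_smul, blockInner_neg_smul_neg_smul] at h2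
  have hLk := hL0 k
  generalize blockInner X _ _ _ _ = g at *
  have h3 : L k / 2 * ((1 / L k) ^ 2 * g) = 1 / (2 * L k) * g := by field_simp
  have h4 : 1 / (2 * L k) * g ≤ cost X (y t k.castSucc) - cost X (y t k.succ) := by
    rw [h3] at h2
    have h5 : -(1 / L k) * g = -2 * (1 / (2 * L k) * g) := by field_simp
    rw [h5] at h2
    linarith
  calc g = 2 * L k * (1 / (2 * L k) * g) := by field_simp
    _ ≤ _ := mul_le_mul_of_nonneg_left h4 (by positivity)

theorem sum_blockInner_grad_le {D : Set (Factors n r)} {L : Fin d → ℝ} (hL0 : ∀ i, 0 < L i)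
    (hD : D ⊆ regularPoints X) (hL : IsBlockLipschitz X D L)
    (hy : IsRPCD X (fun i => 1 / L i) y) (hyD : ∀ t k, y t k ∈ D) (t : ℕ) :
    ∑ k : Fin d, blockInner X (y t k.castSucc) k (grad X (y t k.castSucc) k)
      (grad X (y t k.castSucc) k) ≤
      2 * (⨆ i, L i) * (cost X (y t 0) - cost X (y (t + 1) 0)) := by
  have htel : ∑ k : Fin d, (cost X (y t k.castSucc) - cost X (y t k.succ)) =
      cost X (y t 0) - cost X (y (t + 1) 0) := by
    have h1 := Fin.sum_univ_castSucc fun k => cost X (y t k)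
    have h2 := Fin.sum_univ_succ fun k => cost X (y t k)
    rw [hy.outer, Finset.sum_sub_distrib]
    linarith
  rw [← htel, Finset.mul_sum]
  refine Finset.sum_le_sum fun k _ => ?_
  have h1 := hy.blockInner_grad_le hL0 hD hL hyD t k
  have h2 := blockInner_self_nonneg (hD (hyD t k.castSucc)) k (grad X (y t k.castSucc) k)
  have hk := hL0 k
  have h3 : 0 ≤ cost X (y t k.castSucc) - cost X (y t k.succ) := by
    by_contra! h
    nlinarith
  have h4 : L k ≤ ⨆ i, L i := le_ciSup (Set.finite_range L).bddAbove k
  nlinarith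

/-- The points of one outer iteration are retractions of one another along the steps taken so far,
and the metrics used by `displacementNorm` are those in which the steps were computed. Thus the
gradient along the outer iteration changes by no more than the size of the steps. -/
theorem tangentNorm_grad_sub_sq_le {D : Set (Factors n r)} {L : Fin d → ℝ} (hL0 : ∀ i, 0 < L i)
    (hD : D ⊆ regularPoints X)
    {T : Factors n r → Factors n r → (i : Fin d) →
      Matrix (Fin (n i)) (Fin (r i)) ℝ →ₗ[ℝ] Matrix (Fin (n i)) (Fin (r i)) ℝ} {K : ℝ}
    (hK0 : 0 < K) (hK : IsRetractionLipschitz X D T K)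
    (hy : IsRPCD X (fun i => 1 / L i) y) (hyD : ∀ t k, y t k ∈ D) (t : ℕ) (k : Fin d) :
    tangentNorm X (y t 0) (fun i => grad X (y t 0) i -
        T (y t k.castSucc) (y t 0) i (grad X (y t k.castSucc) i)) ^ 2 ≤
      K ^ 2 / (⨅ i, L i) ^ 2 * ∑ j : Fin d, blockInner X (y t j.castSucc) j
        (grad X (y t j.castSucc) j) (grad X (y t j.castSucc) j) := by
  have hreg t k := hD (hyD t k)
  -- the steps taken before the `k`-th inner iteration
  let ξ : Factors n r := fun j => if j < k then -((1 / L j) • grad X (y t j.castSucc) j) else 0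
  have h := hK (y t 0) (hyD t 0) (y t k.castSucc) (hyD t _)
    (fun j => by rw [hy.mix_eq]; exact hyD t _) ξ ?_ ?_
  · have hnn : 0 ≤ tangentNorm X (y t 0) (fun i => grad X (y t 0) i -
        T (y t k.castSucc) (y t 0) i (grad X (y t k.castSucc) i)) := Real.sqrt_nonneg _
    have hdisp : displacementNorm X (y t 0) (y t k.castSucc) ξ ^ 2 ≤
        1 / (⨅ i, L i) ^ 2 * ∑ j : Fin d, blockInner X (y t j.castSucc) j
        (grad X (y t j.castSucc) j) (grad X (y t j.castSucc) j) := by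
      rw [displacementNorm, Real.sq_sqrt (Finset.sum_nonneg fun j _ => by
        rw [hy.mix_eq]; exact blockInner_self_nonneg (hreg _ _) _ _), Finset.mul_sum]
      refine Finset.sum_le_sum fun j _ => ?_
      have hg := blockInner_self_nonneg (hreg t j.castSucc) j (grad X (y t j.castSucc) j)
      by_cases hjk : j < k
      · rw [hy.mix_eq, min_eq_right (Fin.castSucc_le_castSucc_iff.2 hjk.le)]
        simp only [ξ, if_pos hjk]
        rw [blockInner_neg_smul_neg_smul, ← _root_.one_div_pow]
        refine mul_le_mul_of_nonneg_right ?_ hg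
        have : Nonempty (Fin d) := ⟨j⟩
        obtain ⟨i, hi⟩ := exists_eq_ciInf_of_finite (f := L)
        have h1 : 0 < ⨅ i, L i := hi ▸ hL0 i
        have h2 : ⨅ i, L i ≤ L j := ciInf_le (Set.finite_range L).bddBelow j
        have h3 := hL0 j
        gcongr
      · simp only [ξ, if_neg hjk]
        have h0 : blockInner X (mix (y t 0) (y t k.castSucc) j) j 0 0 = 0 := by simp [blockInner]
        rw [h0]
        positivity
    calc _ ≤ (K * displacementNorm X (y t 0) (y t k.castSucc) ξ) ^ 2 :=
          pow_le_pow_left₀ hnn h 2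
      _ = K ^ 2 * displacementNorm X (y t 0) (y t k.castSucc) ξ ^ 2 := mul_pow _ _ _
      _ ≤ _ := mul_le_mul_of_nonneg_left hdisp (by positivity)
      _ = _ := by ring
  · intro j
    by_cases hjk : j < k
    · simp only [ξ, if_pos hjk]
      rw [← hy.castSucc_apply_self t j]
      exact isHorizontal_neg_smul (isHorizontal_grad X (hreg t j.castSucc) j) _
    · simp only [ξ, if_neg hjk]
      exact Matrix.mul_zero _
  · intro j
    rw [hy.apply_eq t k.castSucc]
    simp only [Fin.castSucc_lt_castSucc_iff]
    by_cases hjk : j < k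
    · simp only [ξ, if_pos hjk]
      rw [← hy.castSucc_apply_self t j]
      exact hy.step t j
    · simp only [ξ, if_neg hjk]
      exact ⟨(hreg t 0).1 j, 1, by rw [add_zero, Matrix.mul_one]⟩

/-- Sufficient decrease in one outer iteration. Each block of the gradient at the start of the outer
iteration is compared with the block that the iteration used, which costs the factor `2`. -/
theorem tangentNorm_grad_sq_le {D : Set (Factors n r)} {L : Fin d → ℝ} (hL0 : ∀ i, 0 < L i)
    (hD : D ⊆ regularPoints X) (hL : IsBlockLipschitz X D L)
    {T : Factors n r → Factors n r → (i : Fin d) →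
      Matrix (Fin (n i)) (Fin (r i)) ℝ →ₗ[ℝ] Matrix (Fin (n i)) (Fin (r i)) ℝ} {K : ℝ}
    (hT : IsIsometricTransport X D T) (hK0 : 0 < K) (hK : IsRetractionLipschitz X D T K)
    (hy : IsRPCD X (fun i => 1 / L i) y) (hyD : ∀ t k, y t k ∈ D) (t : ℕ) :
    tangentNorm X (y t 0) (grad X (y t 0)) ^ 2 ≤
      4 * (⨆ i, L i) * (1 + K ^ 2 / (⨅ i, L i) ^ 2 * d) *
        (cost X (y t 0) - cost X (y (t + 1) 0)) := by
  have hreg t k := hD (hyD t k)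
  have hsum := hy.sum_blockInner_grad_le hL0 hD hL hyD t
  set C := K ^ 2 / (⨅ i, L i) ^ 2 with hC
  have hC0 : 0 ≤ C := by positivity
  set S := ∑ j : Fin d, blockInner X (y t j.castSucc) j
        (grad X (y t j.castSucc) j) (grad X (y t j.castSucc) j) with hS
  have hblock (k : Fin d) : blockInner X (y t 0) k (grad X (y t 0) k) (grad X (y t 0) k) ≤
      2 * blockInner X (y t k.castSucc) k (grad X (y t k.castSucc) k)
        (grad X (y t k.castSucc) k) + 2 * (C * S) := by
    refine (blockInner_self_le_two_mul_add (hreg t 0) k _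
      (T (y t k.castSucc) (y t 0) k (grad X (y t k.castSucc) k))).trans ?_
    rw [hT.isometry _ (hyD t _) _ (hyD t 0) k _ (isHorizontal_grad X (hreg t k.castSucc) k)]
    have h := hy.tangentNorm_grad_sub_sq_le hL0 hD hK0 hK hyD t k
    rw [← hC, ← hS, tangentNorm_sq (hreg t 0)] at h
    have h' := (Finset.single_le_sum (f := fun i => blockInner X (y t 0) i
      (grad X (y t 0) i - T (y t k.castSucc) (y t 0) i (grad X (y t k.castSucc) i))
      (grad X (y t 0) i - T (y t k.castSucc) (y t 0) i (grad X (y t k.castSucc) i)))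
      (fun i _ => blockInner_self_nonneg (hreg t 0) i _) (Finset.mem_univ k)).trans h
    linarith
  calc tangentNorm X (y t 0) (grad X (y t 0)) ^ 2
      ≤ ∑ k : Fin d, (2 * blockInner X (y t k.castSucc) k (grad X (y t k.castSucc) k)
        (grad X (y t k.castSucc) k) + 2 * (C * S)) := by
        rw [tangentNorm_sq (hreg t 0)]
        exact Finset.sum_le_sum fun k _ => hblock k
    _ = 2 * (1 + C * d) * S := by
        rw [Finset.sum_add_distrib, ← Finset.mul_sum, ← hS, Finset.sum_const, Finset.card_univ,
          Fintype.card_fin, nsmul_eq_mul]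
        ring
    _ ≤ 2 * (1 + C * d) * (2 * (⨆ i, L i) * (cost X (y t 0) - cost X (y (t + 1) 0))) :=
        mul_le_mul_of_nonneg_left hsum (by positivity)
    _ = _ := by ring

end IsRPCD

end Descent

end Tucker

theorem mainTheorem3 {d : ℕ} (hd : 0 < d) (n r : Fin d → ℕ) (X : Tucker.Tensor n) :
    -- the cost has restricted Lipschitz-type gradient: block constants exist
    (∃ L : Fin d → ℝ, (∀ i, 0 < L i) ∧
      Tucker.IsBlockLipschitz X (Tucker.regularPoints (r := r) X) L) ∧
    -- on compact sets where the metric is positive definite, the gradient is Lipschitz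
    (∀ D : Set (Tucker.Factors n r), D ⊆ Tucker.regularPoints X → IsCompact D →
      ∃ T, Tucker.IsIsometricTransport X D T ∧
        ∃ LRL : ℝ, 0 < LRL ∧ Tucker.IsRetractionLipschitz X D T LRL) ∧
    -- the rate of convergence, for all such constants
    (∀ (D : Set (Tucker.Factors n r)) (L : Fin d → ℝ)
      (T : Tucker.Factors n r → Tucker.Factors n r → (i : Fin d) →
        Matrix (Fin (n i)) (Fin (r i)) ℝ →ₗ[ℝ] Matrix (Fin (n i)) (Fin (r i)) ℝ) (LRL : ℝ),
      D ⊆ Tucker.regularPoints X →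
      (∀ i, 0 < L i) → Tucker.IsBlockLipschitz X D L →
      Tucker.IsIsometricTransport X D T →
      0 < LRL → Tucker.IsRetractionLipschitz X D T LRL →
      ∀ y : ℕ → Fin (d + 1) → Tucker.Factors n r,
        Tucker.IsRPCD X (fun i => 1 / L i) y → (∀ t k, y t k ∈ D) →
        Tendsto (fun t => Tucker.tangentNorm X (y t 0) (Tucker.grad X (y t 0)) ^ 2) atTop (𝓝 0) ∧
        ∀ (t : ℕ) (ht : 0 < t),
          (Finset.range t).inf' (Finset.nonempty_range_iff.2 ht.ne')
              (fun i => Tucker.tangentNorm X (y i 0) (Tucker.grad X (y i 0))) ≤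
            Real.sqrt ((Tucker.cost X (y 0 0) - Tucker.cost X (y t 0)) *
              (4 * (⨆ i, L i) * (1 + LRL ^ 2 / (⨅ i, L i) ^ 2 * d)) / t)) := by
  refine ⟨⟨fun _ => 1, fun _ => one_pos, Tucker.isBlockLipschitz_one X⟩, fun D hD hc =>
    ⟨Tucker.transport X, Tucker.isIsometricTransport_transport hD,
      Tucker.exists_isRetractionLipschitz_transport hD hc⟩, ?_⟩
  intro D L T K hD hL0 hL hT hK0 hK y hy hyD
  have hdec := hy.tangentNorm_grad_sq_le hL0 hD hL hT hK0 hK hyD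
  have hc0 : 0 ≤ 4 * (⨆ i, L i) * (1 + K ^ 2 / (⨅ i, L i) ^ 2 * d) := by
    have : 0 < ⨆ i, L i :=
      (hL0 ⟨0, hd⟩).trans_le (le_ciSup (Set.finite_range L).bddAbove _)
    positivity
  set c := 4 * (⨆ i, L i) * (1 + K ^ 2 / (⨅ i, L i) ^ 2 * d)
  have hsum (t : ℕ) : ∑ i ∈ Finset.range t, Tucker.tangentNorm X (y i 0)
      (Tucker.grad X (y i 0)) ^ 2 ≤ (Tucker.cost X (y 0 0) - Tucker.cost X (y t 0)) * c := by
    refine (Finset.sum_le_sum fun i _ => hdec i).trans (le_of_eq ?_)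
    rw [← Finset.mul_sum, Finset.sum_range_sub', mul_comm]
  constructor
  · obtain ⟨b, hb⟩ := Tucker.exists_le_cost (r := r) X
    refine (summable_of_sum_range_le (c := (Tucker.cost X (y 0 0) - b) * c)
      (fun t => sq_nonneg _) fun t => (hsum t).trans ?_).tendsto_atTop_zero
    exact mul_le_mul_of_nonneg_right (sub_le_sub_left (hb _ (hD (hyD t 0)).1) _) hc0
  · intro t ht
    have ht' : (0 : ℝ) < t := Nat.cast_pos.2 ht
    refine Real.le_sqrt_of_sq_le ((le_div_iff₀ ht').2 (le_trans ?_ (hsum t)))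
    rw [mul_comm, ← nsmul_eq_mul]
    have hcard := Finset.card_nsmul_le_sum (Finset.range t)
      (fun i => Tucker.tangentNorm X (y i 0) (Tucker.grad X (y i 0)) ^ 2)
      (((Finset.range t).inf' (Finset.nonempty_range_iff.2 ht.ne')
        fun i => Tucker.tangentNorm X (y i 0) (Tucker.grad X (y i 0))) ^ 2)
      fun i hi => pow_le_pow_left₀ (Finset.le_inf' _ _ fun j _ => Real.sqrt_nonneg _)
        (Finset.inf'_le _ hi) 2
    rwa [Finset.card_range] at hcard
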